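/- For real $p$ and $N>1$ put $\gamma(p,N)=2+(N+1)p-(N-1)p^2$ and let $p_S(N)=\frac{N+1+\sqrt{N^2+10N-7}}{2(N-1)}$ be the positive root of $\gamma(\cdot,N)$. For $0<T\le\infty$, $\mu>0$, $p>1$, an energy solution on $[0,T)$ of the Cauchy problem $$u_{tt}-\Delta u+\frac{\mu}{1+t}u_t=|u|^p,\qquad u(x,0)=\varepsilon f(x),\quad u_t(x,0)=\varepsilon g(x)\qquad(x\in\mathbb R^n)$$ is a function $u\in C([0,T),H^1(\mathbb R^n))\cap C^1([0,T),L^2(\mathbb R^n))\cap L^p_{loc}(\mathbb R^n\times[0,T))$ which attains these initial data and satisfies, for every $\phi\in C_0^\infty(\mathbb R^n\times[0,T))$ and every $t\in[0,T)$, $$\int_{\mathbb R^n}u_t(x,t)\phi(x,t)\,dx-\int_{\mathbb R^n}u_t(x,0)\phi(x,0)\,dx+\int_0^t\!\int_{\mathbb R^n}\{-u_t\phi_t+\nabla u\cdot\nabla\phi\}(x,s)\,dx\,ds+\int_0^t\!\int_{\mathbb R^n}\frac{\mu u_t(x,s)}{1+s}\phi(x,s)\,dx\,ds=\int_0^t\!\int_{\mathbb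 R^n}|u(x,s)|^p\phi(x,s)\,dx\,ds.$$ Theorem. Let $n\ge2$ be an integer, $\mu>0$ and $1<p<p_S(n+\mu)$. Let $f\in H^1(\mathbb R^n)$ and $g\in L^2(\mathbb R^n)$ be nonnegative, neither of them vanishing identically (almost everywhere), and let $R\ge1$. Then there are constants $\varepsilon_0>0$ and $C>0$, depending only on $f,g,n,p,\mu,R$, such that the following holds for all $0<\varepsilon\le\varepsilon_0$: if $u$ is an energy solution on $[0,T)$, $0<T\le\infty$, of the above problem and $$\operatorname{supp}u\subset\{(x,t)\in\mathbb R^n\times[0,T):|x|\le t+R\},$$ then $$T\le C\,\varepsilon^{-2p(p-1)/\gamma(p,n+\mu)}.$$ In particular $T<\infty$. No upper bound on $\mu$ is assumed. -/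

import Mathlib

open MeasureTheory Set
open scoped ContDiff Topology

noncomputable section

namespace DampedWave

/-- The Euclidean space `ℝⁿ`. -/
abbrev Space (n : ℕ) := EuclideanSpace ℝ (Fin n)

/-- `γ(p, N) = 2 + (N + 1) p - (N - 1) p²`, for a real dimension parameter `N`. -/
def straussGamma (p N : ℝ) : ℝ := 2 + (N + 1) * p - (N - 1) * p ^ 2

/-- The Strauss exponent `p_S(N)`, the positive root of `γ(·, N)` when `N > 1`. -/
def strauss (N : ℝ) : ℝ :=
  (N + 1 + Real.sqrt (N ^ 2 + 10 * N - 7)) / (2 * (N - 1))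

/-- `w` is the weak gradient of `v` on `ℝⁿ`: `∫ v ∇φ = - ∫ φ w` for all real test functions
`φ ∈ C_c^∞(ℝⁿ)`. It is used only for `v` and `w` in `L²`, where both integrals converge. -/
def IsWeakGradient {n : ℕ} (v : Space n → ℝ) (w : Space n → Space n) : Prop :=
  ∀ φ : Space n → ℝ, ContDiff ℝ ∞ φ → HasCompactSupport φ →
    ∫ x, v x • gradient φ x = - ∫ x, φ x • w x

/-- `v ∈ H¹(ℝⁿ)`: `v` and its weak gradient are in `L²`. -/
def MemH1 {n : ℕ} (v : Space n → ℝ) : Prop :=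
  MemLp v 2 volume ∧ ∃ w : Space n → Space n, MemLp w 2 volume ∧ IsWeakGradient v w

/-- The half-open time interval `[0, T)`, where `T = ∞` is allowed. -/
def timeInterval (T : EReal) : Set ℝ := {t | 0 ≤ t ∧ (t : EReal) < T}

/-- Test functions `φ ∈ C_c^∞(ℝⁿ × [0, T))`, given by smooth extensions to `ℝⁿ × (-∞, T)`;
they need not vanish at time `0`. -/
structure IsTestFunction {n : ℕ} (T : EReal) (φ : Space n × ℝ → ℝ) : Prop where
  contDiff : ContDiff ℝ ∞ φ
  hasCompactSupport : HasCompactSupport φ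
  time_lt : ∀ z ∈ tsupport φ, (z.2 : EReal) < T

/-- The integral identity at time `t`, tested with `φ`. Here `V s` is `u_t(·, s)` and `W s` is
`∇u(·, s)`. -/
def EnergyIdentity {n : ℕ} (μ p : ℝ) (u : Space n × ℝ → ℝ)
    (V : ℝ → Lp ℝ 2 (volume : Measure (Space n)))
    (W : ℝ → Lp (Space n) 2 (volume : Measure (Space n)))
    (φ : Space n × ℝ → ℝ) (t : ℝ) : Prop :=
  (∫ x, V t x * φ (x, t)) - (∫ x, V 0 x * φ (x, 0))
    + (∫ s in (0 : ℝ)..t, ∫ x,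
        (-(V s x * deriv (fun r => φ (x, r)) s)
          + inner ℝ (W s x) (gradient (fun y => φ (y, s)) x)))
    + (∫ s in (0 : ℝ)..t, ∫ x, μ * V s x / (1 + s) * φ (x, s))
  = ∫ s in (0 : ℝ)..t, ∫ x, |u (x, s)| ^ p * φ (x, s)

/-- `u` is an energy solution on `[0, T)` of `u_tt - Δu + μ/(1+t) u_t = |u|^p` with Cauchy data
`u(·, 0) = u₀`, `u_t(·, 0) = u₁`. The curves `U`, `V`, `W` are `t ↦ u(·, t)`, `t ↦ u_t(·, t)` and
`t ↦ ∇u(·, t)` with values in `L²`: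
* `u ∈ C([0, T), H¹)` says that `U` and `W` are continuous into `L²` and `W t` is the weak gradient
  of `U t`;
* `u ∈ C¹([0, T), L²)` says that `U` has the derivative `V` (one-sided at `0`) and `V` is
  continuous;
* `u ∈ L^p_loc(ℝⁿ × [0, T))` says that `u ∈ L^p(K)` for all compact `K ⊆ ℝⁿ × [0, T)`. -/
def IsEnergySolution {n : ℕ} (μ p : ℝ) (T : EReal) (u₀ u₁ : Space n → ℝ)
    (u : Space n × ℝ → ℝ) : Prop :=
  ∃ (U V : ℝ → Lp ℝ 2 (volume : Measure (Space n)))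
    (W : ℝ → Lp (Space n) 2 (volume : Measure (Space n))),
    (∀ t ∈ timeInterval T, ∀ᵐ x, u (x, t) = U t x) ∧
    (∀ t ∈ timeInterval T, IsWeakGradient (U t) (W t)) ∧
    ContinuousOn U (timeInterval T) ∧
    ContinuousOn W (timeInterval T) ∧
    (∀ t ∈ timeInterval T, HasDerivWithinAt U (V t) (timeInterval T) t) ∧
    ContinuousOn V (timeInterval T) ∧
    (∀ K : Set (Space n × ℝ), IsCompact K → K ⊆ univ ×ˢ timeInterval T →
      MemLp u (ENNReal.ofReal p) (volume.restrict K)) ∧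
    (∀ᵐ x, U 0 x = u₀ x) ∧
    (∀ᵐ x, V 0 x = u₁ x) ∧
    (∀ φ : Space n × ℝ → ℝ, IsTestFunction T φ →
      ∀ t ∈ timeInterval T, EnergyIdentity μ p u V W φ t)

/-- `supp u ⊆ {(x, t) ∈ ℝⁿ × [0, T) : |x| ≤ t + R}`: for every `t ∈ [0, T)`, `u(·, t)` vanishes
almost everywhere outside the ball of radius `t + R`. -/
def SupportedInCone {n : ℕ} (T : EReal) (R : ℝ) (u : Space n × ℝ → ℝ) : Prop :=
  ∀ t ∈ timeInterval T, ∀ᵐ x : Space n, t + R < ‖x‖ → u (x, t) = 0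

end DampedWave

end

/-! The proof tracks two moments of the solution. For a smooth nonnegative `φ` with `Δφ = κφ`,
finite speed of propagation lets `φ`, after a cutoff beyond the cone, be used as a test function.
The moment `∫ u φ` then solves `h'' + μ/(1+t) h' = κ h + P`, with `P ≥ ∫ |u|^p φ` over the ball of
radius `t + R` (`exists_moment_ode`).

For `κ = 1` take `φ` radial of Bessel type, growing like `e^r r^(-(n-1)/2)`. Since `P ≥ 0`, the
moment `H` satisfies `H'' + μ/(1+t) H' ≥ H`. A Riccati comparison valid for every `μ ≥ 0` gives `H ≥
c ε e^t (1+t)^(-μ/2)` (`exp_growth`). Hölder against `φ` on the ball of radius `t + R` cancels the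
exponentials and leaves `∫ |u|^p ≥ c ε^p (1+t)^σ` with `σ = n - 1 - (n+μ-1)p/2`
(`exists_lower_bound_rpow_mass`). The loss `(1+t)^(-μ/2)` is what shifts the dimension from `n` to
`n + μ`.

For `κ = 0` take `φ = 1`, so that `F = ∫ u` solves `F'' + μ/(1+t) F' = P`. On `[τ/4, τ]` the forcing
is at least a multiple of `ε^p τ^σ`, and on `[0, τ]` Hölder gives `P ≥ b τ^(-n(p-1)) |F|^p`
(`exists_mean_rpow_le`). On this scale the damping costs only a factor `(1/4)^μ`, so a doubling
iteration on shrinking intervals ending at `τ` makes `F(τ)` infinite unless a certain product of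
these constants is below `1` (`kato_bound`). That product is `K ε^(p(p-1)) τ^(γ/2)`. As `γ > 0`
below the Strauss exponent, this bounds `τ`, and hence `T`. -/

noncomputable section

namespace DampedWave

/-! ### Differential inequalities with scale-invariant damping -/

/-- If `v' ≥ A` in the integrated sense and `E ≥ 0` is differentiable, then `(E v)' ≥ E' v + E A`,
in the sense that any `K` with `K' ≤ E' v + E A` grows at most as much as `E v`. -/
lemma sub_le_weighted_sub {v A E E' K K' : ℝ → ℝ} {a b : ℝ} (hab : a ≤ b)
    (hv : ContinuousOn v (Icc a b)) (hA : ContinuousOn A (Icc a b))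
    (hE : ∀ x ∈ Icc a b, HasDerivAt E (E' x) x) (hE0 : ∀ x ∈ Icc a b, 0 ≤ E x)
    (hK : ∀ x ∈ Icc a b, HasDerivWithinAt K (K' x) (Icc a b) x)
    (hle : ∀ x ∈ Icc a b, K' x ≤ E' x * v x + E x * A x)
    (h : ∀ s ∈ Icc a b, ∀ t ∈ Icc a b, s ≤ t → ∫ r in s..t, A r ≤ v t - v s) :
    K b - K a ≤ E b * v b - E a * v a := by
  have hEc : ContinuousOn E (Icc a b) := fun x hx => (hE x hx).continuousAt.continuousWithinAt
  have hKc : ContinuousOn K (Icc a b) := fun x hx => (hK x hx).continuousWithinAt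
  -- `v` is only continuous with an integrated inequality, so the comparison goes through right
  -- difference quotients of `-E v` instead of a derivative.
  have key := image_le_of_liminf_slope_right_le_deriv_boundary
    (f := fun x => -(E x * v x)) (a := a) (b := b)
    (B := fun x => -(E a * v a) + K a - K x) (B' := fun x => - K' x)
    (hEc.mul hv).neg (by simp) (continuousOn_const.sub hKc) ?_ ?_ (right_mem_Icc.2 hab)
  · linarith
  · intro x hx
    have h1 : HasDerivWithinAt K (K' x) (Ici x) x :=
      ((hK x ⟨hx.1, hx.2.le⟩).mono (Icc_subset_Icc_left hx.1)).mono_of_mem_nhdsWithin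
        (Icc_mem_nhdsGE hx.2)
    simpa using h1.const_sub (-(E a * v a) + K a)
  · intro x hx r hr
    have hxI : x ∈ Icc a b := ⟨hx.1, hx.2.le⟩
    have hAx : ContinuousOn A (Icc x b) := hA.mono (Icc_subset_Icc_left hx.1)
    have hAw : ContinuousWithinAt A (Ioi x) x :=
      ((hAx x (left_mem_Icc.2 hx.2.le)).mono_of_mem_nhdsWithin (Icc_mem_nhdsGE hx.2)).mono
        Ioi_subset_Ici_self
    have hJ : HasDerivWithinAt (fun z => ∫ y in x..z, A y) (A x) (Ici x) x := by
      refine intervalIntegral.integral_hasDerivWithinAt_right (t := Ioi x)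
        IntervalIntegrable.refl ?_ hAw
      exact ⟨Ioc x b, Ioc_mem_nhdsGT hx.2,
        (hAx.mono Ioc_subset_Icc_self).aestronglyMeasurable measurableSet_Ioc⟩
    have hJ' := (hasDerivWithinAt_iff_tendsto_slope.1 hJ)
    have hE' := (hasDerivWithinAt_iff_tendsto_slope.1
      ((hE x hxI).hasDerivWithinAt (s := Ici x)))
    rw [Ici_sdiff_left] at hJ' hE'
    have hEt : Filter.Tendsto E (𝓝[>] x) (𝓝 (E x)) :=
      (hE x hxI).continuousAt.tendsto.mono_left nhdsWithin_le_nhds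
    have hlim := ((hEt.mul hJ').add (hE'.mul_const (v x))).neg
    have hlt : -(E x * A x + E' x * v x) < r := by
      have := hle x hxI
      linarith
    have hev := hlim.eventually_lt_const hlt
    refine Filter.Eventually.frequently ?_
    filter_upwards [hev, Ioc_mem_nhdsGT hx.2] with z hz hzb
    refine lt_of_le_of_lt ?_ hz
    have hzx : 0 < z - x := sub_pos.2 hzb.1
    have hzI : z ∈ Icc a b := ⟨hx.1.trans hzb.1.le, hzb.2⟩
    have h2 := mul_le_mul_of_nonneg_left (h x hxI z hzI hzb.1.le) (hE0 z hzI)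
    rw [slope_def_field, slope_def_field, slope_def_field, intervalIntegral.integral_same]
    -- Discrete product rule: the quotient of `E v` is `E z` times that of `v` plus `v x` times that
    -- of `E`. Since `E z ≥ 0`, the first term is at least `E z` times the mean of `A` over `[x,
    -- z]`.
    have : -(E z * ((∫ y in x..z, A y - 0) / (z - x)) + (E z - E x) / (z - x) * v x)
        - (-(E z * v z) - -(E x * v x)) / (z - x)
        = (E z * (v z - v x) - E z * (∫ y in x..z, A y)) / (z - x) := by
      simp only [sub_zero]
      field_simp
      ring
    have h3 : 0 ≤ (E z * (v z - v x) - E z * (∫ y in x..z, A y)) / (z - x) :=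
      div_nonneg (by linarith) hzx.le
    simp only [sub_zero] at this ⊢
    linarith

lemma hasDerivAt_one_add_rpow (μ : ℝ) {x : ℝ} (hx : 0 ≤ x) :
    HasDerivAt (fun y : ℝ => (1 + y) ^ μ) (μ / (1 + x) * (1 + x) ^ μ) x := by
  have h1 : (0 : ℝ) < 1 + x := by linarith
  have := ((hasDerivAt_id' x).const_add 1).rpow_const (p := μ) (Or.inl h1.ne')
  convert this using 1
  rw [Real.rpow_sub_one h1.ne']
  ring

lemma continuousOn_div_one_add (μ : ℝ) {a b : ℝ} (ha : 0 ≤ a) :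
    ContinuousOn (fun x : ℝ => μ / (1 + x)) (Icc a b) := by
  refine continuousOn_const.div (by fun_prop) fun x hx => ?_
  have := ha.trans hx.1
  positivity

/-- A forcing of size `m` from time `a` on produces velocity. -/
lemma damped_velocity_ge {v : ℝ → ℝ} {a b μ m : ℝ} (ha : 0 ≤ a) (hab : a ≤ b) (hμ : 0 ≤ μ)
    (hm : 0 ≤ m) (hv : ContinuousOn v (Icc a b)) (hva : 0 ≤ v a)
    (h : ∀ s ∈ Icc a b, ∀ t ∈ Icc a b, s ≤ t →
      ∫ r in s..t, (m - μ / (1 + r) * v r) ≤ v t - v s) :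
    ((1 + a) / (1 + b)) ^ μ * (m * (b - a)) ≤ v b := by
  have h1a : (0 : ℝ) < 1 + a := by linarith
  have h1b : (0 : ℝ) < 1 + b := by linarith
  have key := sub_le_weighted_sub (K := fun x => (1 + a) ^ μ * m * x)
    (K' := fun _ => (1 + a) ^ μ * m) hab hv
    (continuousOn_const.sub ((continuousOn_div_one_add μ ha).mul hv))
    (E := fun y => (1 + y) ^ μ) (E' := fun x => μ / (1 + x) * (1 + x) ^ μ)
    (fun x hx => hasDerivAt_one_add_rpow μ (ha.trans hx.1))
    (fun x hx => by have := ha.trans hx.1; positivity)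
    (fun x _ => by simpa using ((hasDerivAt_id x).const_mul ((1 + a) ^ μ * m)).hasDerivWithinAt)
    (fun x hx => by
      have : (1 + a) ^ μ ≤ (1 + x) ^ μ :=
        Real.rpow_le_rpow h1a.le (by linarith [hx.1]) hμ
      have h2 := mul_le_mul_of_nonneg_right this hm
      simp only [Pi.sub_apply, Pi.mul_apply]
      linarith) h
  have hpa : 0 ≤ (1 + a) ^ μ * v a := by positivity
  have hpb : 0 < (1 + b) ^ μ := by positivity
  rw [Real.div_rpow h1a.le h1b.le, div_mul_eq_mul_div, div_le_iff₀ hpb]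
  linarith

/-- The forcing `H` itself propagates positivity: `H'' + μ/(1+t) H' ≥ H` with nonnegative data. -/
lemma pos_and_velocity_nonneg {H v : ℝ → ℝ} {τ μ : ℝ} (hμ : 0 ≤ μ)
    (hv : ContinuousOn v (Icc 0 τ))
    (hH : ∀ t ∈ Icc 0 τ, HasDerivWithinAt H (v t) (Icc 0 τ) t)
    (hH0 : 0 < H 0) (hv0 : 0 ≤ v 0)
    (h : ∀ s ∈ Icc 0 τ, ∀ t ∈ Icc 0 τ, s ≤ t →
      ∫ r in s..t, (H r - μ / (1 + r) * v r) ≤ v t - v s) :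
    ∀ t ∈ Icc 0 τ, H 0 ≤ H t ∧ 0 ≤ v t := by
  have hHc : ContinuousOn H (Icc 0 τ) := fun x hx => (hH x hx).continuousWithinAt
  have hvel : ∀ t ∈ Icc 0 τ, (∀ s ∈ Ico 0 t, 0 ≤ H s) → 0 ≤ v t := by
    intro t ht hs
    have hsub : Icc 0 t ⊆ Icc 0 τ := Icc_subset_Icc_right ht.2
    have := damped_velocity_ge le_rfl ht.1 hμ le_rfl (hv.mono hsub) hv0 (fun a ha b hb hab => by
      refine le_trans ?_ (h a (hsub ha) b (hsub hb) hab)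
      have hI : Icc a b ⊆ Icc 0 τ := (Icc_subset_Icc ha.1 hb.2).trans hsub
      have c1 : ContinuousOn (fun r => μ / (1 + r) * v r) (Icc a b) :=
        (continuousOn_div_one_add μ ha.1).mul (hv.mono hI)
      refine intervalIntegral.integral_mono_on_of_le_Ioo hab
        ((continuousOn_const.sub c1).intervalIntegrable_of_Icc hab)
        (((hHc.mono hI).sub c1).intervalIntegrable_of_Icc hab) fun x hx => ?_
      have := hs x ⟨ha.1.trans hx.1.le, hx.2.trans_le hb.2⟩
      linarith)
    simpa using this
  have hmono : ∀ t ∈ Icc 0 τ, (∀ s ∈ Ico 0 t, 0 ≤ H s) → H 0 ≤ H t := by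
    intro t ht hs
    have hsub : Icc 0 t ⊆ Icc 0 τ := Icc_subset_Icc_right ht.2
    have hm : MonotoneOn H (Icc 0 t) := by
      refine monotoneOn_of_hasDerivWithinAt_nonneg (f' := v) (convex_Icc 0 t) (hHc.mono hsub)
        (fun x hx => (hH x (hsub (interior_subset hx))).mono (interior_subset.trans hsub)) ?_
      intro x hx
      have hx' := interior_subset hx
      exact hvel x (hsub hx') fun s hs' => hs s ⟨hs'.1, hs'.2.trans_le hx'.2⟩
    exact hm (left_mem_Icc.2 ht.1) (right_mem_Icc.2 ht.1) ht.1
  -- Continuity argument: before the first time `m` with `H m ≤ 0` the function is nonnegative,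
  -- hence nondecreasing up to `m`, so `H m ≥ H 0 > 0`.
  have hpos : ∀ t ∈ Icc 0 τ, 0 < H t := by
    by_contra! hcon
    obtain ⟨t, ht, hHt⟩ := hcon
    have hS : IsCompact (Icc 0 τ ∩ H ⁻¹' Iic 0) :=
      isCompact_Icc.of_isClosed_subset (hHc.preimage_isClosed_of_isClosed isClosed_Icc isClosed_Iic)
        inter_subset_left
    obtain ⟨m, hm, hmin⟩ := hS.exists_isLeast ⟨t, ht, hHt⟩
    have := hmono m hm.1 fun s hs => by
      by_contra! hneg
      have := hmin ⟨⟨hs.1, hs.2.le.trans hm.1.2⟩, hneg.le⟩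
      exact absurd hs.2 (not_lt.2 this)
    have h2 : H m ≤ 0 := hm.2
    linarith
  intro t ht
  have hs : ∀ s ∈ Ico 0 t, 0 ≤ H s := fun s hs => (hpos s ⟨hs.1, hs.2.le.trans ht.2⟩).le
  exact ⟨hmono t ht hs, hvel t ht hs⟩

/-- Growth of solutions of `H'' + μ/(1+t) H' ≥ H` with nonnegative data, by comparison of the
logarithmic derivative with the Riccati subsolution
`1 - μ / (2 (1 + t)) - (μ + 3)² / (1 + t)²`. -/
lemma exp_growth {H v : ℝ → ℝ} {τ μ : ℝ} (hμ : 0 ≤ μ)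
    (hv : ContinuousOn v (Icc 0 τ))
    (hH : ∀ t ∈ Icc 0 τ, HasDerivWithinAt H (v t) (Icc 0 τ) t)
    (hH0 : 0 < H 0) (hv0 : 0 ≤ v 0)
    (h : ∀ s ∈ Icc 0 τ, ∀ t ∈ Icc 0 τ, s ≤ t →
      ∫ r in s..t, (H r - μ / (1 + r) * v r) ≤ v t - v s) :
    ∀ t ∈ Icc (μ + 2) τ,
      H 0 * Real.exp (-(2 * μ + 5)) * (Real.exp t * (1 + t) ^ (-(μ / 2))) ≤ H t := by
  have hpos := pos_and_velocity_nonneg hμ hv hH hH0 hv0 h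
  have hHc : ContinuousOn H (Icc 0 τ) := fun x hx => (hH x hx).continuousWithinAt
  -- This `b` makes `b / (1 + t)² = 1` at `t = μ + 2`, so `q ≤ 0` there and the comparison `v ≥ q H`
  -- holds at the starting time. It is also large enough for the Riccati inequality afterwards.
  set b : ℝ := (μ + 3) ^ 2 with hb
  set q : ℝ → ℝ := fun t => 1 - μ / (2 * (1 + t)) - b / (1 + t) ^ 2 with hq
  -- `L (-μ/2)` is a primitive of `q` and `L (μ/2)` one of `q + μ/(1+t)`. The first integrates `H' ≥
  -- q H`; the second is the exponent of the integrating factor for `v - q H`.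
  set L : ℝ → ℝ → ℝ := fun c t => t + c * Real.log (1 + t) + b / (1 + t) with hL
  have hLd : ∀ c, ∀ t, 0 ≤ t → HasDerivAt (L c) (1 + c / (1 + t) - b / (1 + t) ^ 2) t := by
    intro c t ht
    have h1 : (1 : ℝ) + t ≠ 0 := by positivity
    have h2 := (hasDerivAt_id' t).const_add 1
    exact (((hasDerivAt_id' t).add ((h2.log h1).const_mul c)).add
      ((hasDerivAt_const t b).div h2 h1)).congr_deriv (by ring)
  have hqd : ∀ t, 0 ≤ t → HasDerivAt q (μ / (2 * (1 + t) ^ 2) + 2 * b / (1 + t) ^ 3) t := by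
    intro t ht
    have h1 : (1 : ℝ) + t ≠ 0 := by positivity
    have h2 := (hasDerivAt_id' t).const_add 1
    exact ((((hasDerivAt_const t μ).div (h2.const_mul 2) (by positivity)).const_sub 1).sub
      ((hasDerivAt_const t b).div (h2.fun_pow 2) (by positivity))).congr_deriv (by
        field_simp
        ring)
  have hslope : ∀ t ∈ Icc (μ + 2) τ, q t * H t ≤ v t := by
    intro t ht
    have hsub : Icc (μ + 2) t ⊆ Icc 0 τ := Icc_subset_Icc (by linarith) ht.2
    have hT := hsub (left_mem_Icc.2 ht.1)
    -- With `w = v - q H`, the inequality `q' + q² + μ/(1+t) q ≤ 1` and `H ≥ 0` yield `w' ≥ -(q +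
    -- μ/(1+t)) w`; thus `exp (L (μ/2)) * w` does not decrease.
    have key := sub_le_weighted_sub (E := fun x => Real.exp (L (μ / 2) x))
      (E' := fun x => Real.exp (L (μ / 2) x) * (1 + μ / 2 / (1 + x) - b / (1 + x) ^ 2))
      (A := fun r => H r - μ / (1 + r) * v r)
      (K := fun x => Real.exp (L (μ / 2) x) * q x * H x)
      (K' := fun x => (Real.exp (L (μ / 2) x) * (1 + μ / 2 / (1 + x) - b / (1 + x) ^ 2) * q x
        + Real.exp (L (μ / 2) x) * (μ / (2 * (1 + x) ^ 2) + 2 * b / (1 + x) ^ 3)) * H x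
        + Real.exp (L (μ / 2) x) * q x * v x)
      ht.1 (hv.mono hsub)
      ((hHc.mono hsub).sub ((continuousOn_div_one_add μ (by linarith)).mul (hv.mono hsub)))
      (fun x hx => (hLd _ x (hsub hx).1).exp) (fun x _ => (Real.exp_pos _).le)
      (fun x hx => ((((hLd _ x (hsub hx).1).exp).mul (hqd x (hsub hx).1)).hasDerivWithinAt).mul
        ((hH x (hsub hx)).mono hsub)) ?_
      (fun s hs t ht hst => h s (hsub hs) t (hsub ht) hst)
    · have hqT : q (μ + 2) ≤ 0 := by
        have : b / (1 + (μ + 2)) ^ 2 = 1 := by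
          rw [hb, show 1 + (μ + 2) = μ + 3 by ring]
          exact div_self (by positivity)
        have h3 : 0 ≤ μ / (2 * (1 + (μ + 2))) := by positivity
        simp only [hq]
        linarith
      have h4 := hpos _ hT
      have h5 : q (μ + 2) * H (μ + 2) ≤ 0 :=
        mul_nonpos_of_nonpos_of_nonneg hqT (hH0.le.trans h4.1)
      have e1 := Real.exp_pos (L (μ / 2) (μ + 2))
      have e2 := Real.exp_pos (L (μ / 2) t)
      have h6 : 0 ≤ Real.exp (L (μ / 2) t) * (v t - q t * H t) := by
        nlinarith [mul_nonneg e1.le h4.2, mul_nonneg e1.le (neg_nonneg.2 h5)]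
      have := nonneg_of_mul_nonneg_right h6 e2
      linarith
    · intro x hx
      have hx0 := (hsub hx).1
      have hHx : 0 ≤ H x := hH0.le.trans (hpos x (hsub hx)).1
      have e2 := Real.exp_pos (L (μ / 2) x)
      obtain ⟨y, hy⟩ : ∃ y, y = 1 / (1 + x) := ⟨_, rfl⟩
      have hy1 : y * (μ + 3) ≤ 1 := by
        rw [hy, div_mul_eq_mul_div, one_mul]
        exact div_le_one_of_le₀ (by linarith [hx.1]) (by linarith)
      have hy0 : 0 ≤ y := by rw [hy]; positivity
      have hric : (1 + μ / 2 / (1 + x) - b / (1 + x) ^ 2) * q x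
          + (μ / (2 * (1 + x) ^ 2) + 2 * b / (1 + x) ^ 3) ≤ 1 := by
        have : (1 + μ / 2 / (1 + x) - b / (1 + x) ^ 2) * q x
          + (μ / (2 * (1 + x) ^ 2) + 2 * b / (1 + x) ^ 3)
          = 1 + y ^ 2 * (μ / 2 - μ ^ 2 / 4 - 2 * b + 2 * b * y + b * b * y ^ 2) := by
          simp only [hq, hy]
          field_simp
          ring
        rw [this]
        have hz : b * y ≤ μ + 3 := by rw [hb]; nlinarith
        have hz' : b * b * y ^ 2 ≤ b := by
          have : b * y ^ 2 ≤ 1 := by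
            rw [hb, ← mul_pow, mul_comm]
            exact pow_le_one₀ (by positivity) hy1
          nlinarith [sq_nonneg (μ + 3)]
        have : μ / 2 - μ ^ 2 / 4 - 2 * b + 2 * b * y + b * b * y ^ 2 ≤ 0 := by
          nlinarith [sq_nonneg μ]
        nlinarith [sq_nonneg y]
      have h7 := mul_le_mul_of_nonneg_left hric (mul_nonneg e2.le hHx)
      have h8 : μ / (2 * (1 + x)) = μ / 2 / (1 + x) := by field_simp
      have h9 : μ / (1 + x) = 2 * (μ / 2 / (1 + x)) := by field_simp
      simp only [hq, h8, h9] at h7 ⊢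
      nlinarith
  intro t ht
  have hsub : Icc (μ + 2) t ⊆ Icc 0 τ := Icc_subset_Icc (by linarith) ht.2
  have hmono : MonotoneOn (fun x => H x * Real.exp (-L (-(μ / 2)) x)) (Icc (μ + 2) t) := by
    refine monotoneOn_of_hasDerivWithinAt_nonneg (convex_Icc _ _)
      (f' := fun x => v x * Real.exp (-L (-(μ / 2)) x) + H x * (Real.exp (-L (-(μ / 2)) x)
        * -(1 + -(μ / 2) / (1 + x) - b / (1 + x) ^ 2)))
      ((hHc.mono hsub).mul ?_) ?_ ?_
    · exact fun x hx => (hLd _ x (hsub hx).1).neg.exp.continuousAt.continuousWithinAt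
    · intro x hx
      have hx' := hsub (interior_subset hx)
      exact ((hH x hx').mono (interior_subset.trans hsub)).mul
        (hLd _ x hx'.1).neg.exp.hasDerivWithinAt
    · intro x hx
      have hx' := interior_subset hx
      have h1 := hslope x ⟨hx'.1, hx'.2.trans ht.2⟩
      have e2 := Real.exp_pos (-L (-(μ / 2)) x)
      have h2 : q x = 1 + -(μ / 2) / (1 + x) - b / (1 + x) ^ 2 := by
        have := (hsub hx').1
        simp only [hq]
        field_simp
        ring
      rw [h2] at h1
      nlinarith
  have h1 := hmono (left_mem_Icc.2 ht.1) (right_mem_Icc.2 ht.1) ht.1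
  simp only at h1
  have h2 := (hpos _ (hsub (left_mem_Icc.2 ht.1))).1
  have ht0 : 0 ≤ t := by linarith [ht.1]
  have h3 : H (μ + 2) * (Real.exp (L (-(μ / 2)) t) * Real.exp (-L (-(μ / 2)) (μ + 2))) ≤ H t := by
    have h4 := mul_le_mul_of_nonneg_left h1 (Real.exp_pos (L (-(μ / 2)) t)).le
    have h5 : Real.exp (L (-(μ / 2)) t) * (H t * Real.exp (-L (-(μ / 2)) t)) = H t := by
      rw [mul_left_comm, ← Real.exp_add]; simp
    rw [h5] at h4
    linarith
  refine le_trans ?_ h3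
  rw [mul_assoc, Real.rpow_def_of_pos (by linarith), ← Real.exp_add, ← Real.exp_add,
    ← Real.exp_add]
  refine mul_le_mul h2 (Real.exp_le_exp.2 ?_) (Real.exp_pos _).le (hH0.le.trans h2)
  -- The constant `2μ + 5` is `(μ + 2) + b / (μ + 3)`, the value of `L (-μ/2)` at `μ + 2` without
  -- its logarithm, whose sign is favourable.
  have h6 : 0 ≤ μ / 2 * Real.log (1 + (μ + 2)) :=
    mul_nonneg (by positivity) (Real.log_nonneg (by linarith))
  have h7 : b / (1 + (μ + 2)) = μ + 3 := by
    rw [hb, show 1 + (μ + 2) = μ + 3 by ring]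
    field_simp
  have h8 : 0 ≤ b / (1 + t) := by positivity
  simp only [hL, h7]
  linarith

/-- A forcing of size `m` on `[a, τ]`, `a ≥ τ / 4`, makes the solution at least
`4^(-μ) m (t - a)² / 2`. -/
lemma forced_growth {F v P : ℝ → ℝ} {τ μ a m : ℝ} (hμ : 0 ≤ μ) (ha0 : 0 ≤ a) (ha : τ / 4 ≤ a)
    (hm : 0 ≤ m) (hv : ContinuousOn v (Icc 0 τ))
    (hF : ∀ t ∈ Icc 0 τ, HasDerivWithinAt F (v t) (Icc 0 τ) t)
    (hFa : 0 ≤ F a) (hva : 0 ≤ v a)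
    (hPi : IntervalIntegrable P volume 0 τ)
    (hP : ∀ᵐ r, r ∈ Icc a τ → m ≤ P r)
    (h : ∀ s ∈ Icc 0 τ, ∀ t ∈ Icc 0 τ, s ≤ t →
      v t - v s = ∫ r in s..t, (P r - μ / (1 + r) * v r)) :
    ∀ t ∈ Icc a τ, (1 / 4) ^ μ * m * ((t - a) ^ 2 / 2) ≤ F t := by
  have hFc : ContinuousOn F (Icc 0 τ) := fun x hx => (hF x hx).continuousWithinAt
  intro t ht
  have hsub : Icc a t ⊆ Icc 0 τ := Icc_subset_Icc ha0 ht.2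
  have hvel : ∀ x ∈ Icc a t, (1 / 4) ^ μ * m * (x - a) ≤ v x := by
    intro x hx
    have hI : Icc a x ⊆ Icc 0 τ := (Icc_subset_Icc_right hx.2).trans hsub
    have := damped_velocity_ge ha0 hx.1 hμ hm (hv.mono hI) hva (fun s hs r hr hsr => by
      rw [h s (hI hs) r (hI hr) hsr]
      have hJ : Icc s r ⊆ Icc 0 τ := (Icc_subset_Icc hs.1 hr.2).trans hI
      have c1 : IntervalIntegrable (fun r => μ / (1 + r) * v r) volume s r :=
        ((continuousOn_div_one_add μ (ha0.trans hs.1)).mul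
          (hv.mono hJ)).intervalIntegrable_of_Icc hsr
      have c2 : IntervalIntegrable P volume s r := hPi.mono_set (by
        rw [uIcc_of_le hsr, uIcc_of_le ((hsub hx).1.trans (hsub hx).2)]; exact hJ)
      refine intervalIntegral.integral_mono_ae_restrict hsr (intervalIntegrable_const.sub c1)
        (c2.sub c1) ?_
      rw [Filter.EventuallyLE, ae_restrict_iff' measurableSet_Icc]
      filter_upwards [hP] with y hy hy'
      have := hy ⟨hs.1.trans hy'.1, hy'.2.trans (hr.2.trans (hx.2.trans ht.2))⟩
      linarith)
    refine le_trans ?_ this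
    rw [mul_assoc]
    have hx0 := (hsub hx).1
    -- The damping factor `(1 + a) / (1 + x)` is at least `1/4` because `x ≤ τ ≤ 4a`.
    refine mul_le_mul_of_nonneg_right (Real.rpow_le_rpow (by norm_num) ?_ hμ)
      (mul_nonneg hm (by linarith [hx.1]))
    rw [div_le_div_iff₀ (by norm_num) (by linarith)]
    linarith [(hsub hx).2]
  have hmono : MonotoneOn (fun x => F x - (1 / 4) ^ μ * m * ((x - a) ^ 2 / 2)) (Icc a t) := by
    refine monotoneOn_of_hasDerivWithinAt_nonneg (convex_Icc _ _)
      (f' := fun x => v x - (1 / 4) ^ μ * m * (x - a))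
      ((hFc.mono hsub).sub (by fun_prop)) ?_ ?_
    · intro x hx
      refine ((hF x (hsub (interior_subset hx))).mono (interior_subset.trans hsub)).sub ?_
      exact ((((((hasDerivAt_id' x).sub_const a).fun_pow 2).div_const 2).const_mul
        ((1 / 4) ^ μ * m)).congr_deriv (by simp)).hasDerivWithinAt
    · intro x hx
      have := hvel x (interior_subset hx)
      linarith
  have := hmono (left_mem_Icc.2 ht.1) (right_mem_Icc.2 ht.1) ht.1
  simp only at this
  nlinarith

/-- Kato-type blow-up on a bounded interval: a global solution of
`F'' + μ/(1+t) F' ≥ B |F|^p` on `[0, τ]` pushed by a forcing `m` cannot be too large. -/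
lemma kato_bound {F v P : ℝ → ℝ} {τ μ p m B : ℝ} (hτ : 0 < τ) (hμ : 0 ≤ μ) (hp : 1 < p)
    (hm : 0 < m) (hB : 0 < B) (hv : ContinuousOn v (Icc 0 τ))
    (hF : ∀ t ∈ Icc 0 τ, HasDerivWithinAt F (v t) (Icc 0 τ) t)
    (hF0 : 0 ≤ F 0) (hv0 : 0 ≤ v 0)
    (hPi : IntervalIntegrable P volume 0 τ)
    (hPm : ∀ᵐ r, r ∈ Icc (τ / 4) τ → m ≤ P r)
    (hPF : ∀ᵐ r, r ∈ Icc 0 τ → B * |F r| ^ p ≤ P r)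
    (h : ∀ s ∈ Icc 0 τ, ∀ t ∈ Icc 0 τ, s ≤ t →
      v t - v s = ∫ r in s..t, (P r - μ / (1 + r) * v r)) :
    (1 / 4) ^ μ * (1 - (2 : ℝ) ^ (-((p - 1) / 2))) ^ 2 / 16 *
      (B * ((1 / 4) ^ μ * m * (τ ^ 2 / 32)) ^ (p - 1) * τ ^ 2) < 1 := by
  have hFc : ContinuousOn F (Icc 0 τ) := fun x hx => (hF x hx).continuousWithinAt
  have hvel : ∀ t ∈ Icc 0 τ, 0 ≤ v t := by
    intro t ht
    have hsub : Icc 0 t ⊆ Icc 0 τ := Icc_subset_Icc_right ht.2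
    have := damped_velocity_ge le_rfl ht.1 hμ le_rfl (hv.mono hsub) hv0 (fun a ha b hb hab => by
      rw [h a (hsub ha) b (hsub hb) hab]
      have hI : Icc a b ⊆ Icc 0 τ := (Icc_subset_Icc ha.1 hb.2).trans hsub
      have c1 : IntervalIntegrable (fun r => μ / (1 + r) * v r) volume a b :=
        ((continuousOn_div_one_add μ ha.1).mul (hv.mono hI)).intervalIntegrable_of_Icc hab
      have c2 : IntervalIntegrable P volume a b := hPi.mono_set (by
        rw [uIcc_of_le hab, uIcc_of_le hτ.le]; exact hI)
      refine intervalIntegral.integral_mono_ae_restrict hab (intervalIntegrable_const.sub c1)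
        (c2.sub c1) ?_
      rw [Filter.EventuallyLE, ae_restrict_iff' measurableSet_Icc]
      filter_upwards [hPF] with y hy hy'
      have := hy (hI hy')
      have h0 : 0 ≤ B * |F y| ^ p := by positivity
      linarith)
    simpa using this
  have hFnn : ∀ t ∈ Icc 0 τ, 0 ≤ F t := by
    intro t ht
    have hm : MonotoneOn F (Icc 0 τ) :=
      monotoneOn_of_hasDerivWithinAt_nonneg (f' := v) (convex_Icc 0 τ) hFc
        (fun x hx => (hF x (interior_subset hx)).mono interior_subset)
        (fun x hx => hvel x (interior_subset hx))
    exact hF0.trans (hm (left_mem_Icc.2 hτ.le) ht ht.1)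
  by_contra! hcon
  -- Doubling `F` multiplies the forcing by `2^p`, while shrinking the time left by `θ` multiplies
  -- its square by `θ²`. This `θ` gives `2^p θ² = 2`, so each step again gains a factor `2`.
  set θ : ℝ := (2 : ℝ) ^ (-((p - 1) / 2)) with hθ
  have hθ0 : 0 < θ := by positivity
  have hθ1 : θ ≤ 1 := Real.rpow_le_one_of_one_le_of_nonpos (by norm_num) (by linarith)
  set M : ℝ := (1 / 4) ^ μ * m * (τ ^ 2 / 32) with hM
  have hM0 : 0 < M := by positivity
  have hθ2 : (2 : ℝ) ^ p * θ ^ 2 = 2 := by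
    rw [hθ, ← Real.rpow_natCast, ← Real.rpow_mul (by norm_num), ← Real.rpow_add (by norm_num)]
    norm_num
  have hMp : M ^ p = M ^ (p - 1) * M := by
    rw [Real.rpow_sub_one hM0.ne']; field_simp
  -- All these intervals contain `τ`, so the bounds `M 2^j` accumulate at one point. `M` is the
  -- effect of the forcing `m` from `τ/4` on, read off after `τ/2`: `(τ/4)² / 2 = τ² / 32`.
  have hstep : ∀ j : ℕ, ∀ t ∈ Icc (τ - τ / 2 * θ ^ j) τ, M * 2 ^ j ≤ F t := by
    intro j
    induction j with
    | zero =>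
      intro t ht
      simp only [pow_zero, mul_one] at ht ⊢
      have := forced_growth hμ (by positivity) le_rfl hm.le hv hF
        (hFnn _ ⟨by positivity, by linarith⟩) (hvel _ ⟨by positivity, by linarith⟩) hPi hPm h t
        ⟨by linarith [ht.1], ht.2⟩
      refine le_trans ?_ this
      rw [hM]
      refine mul_le_mul_of_nonneg_left ?_ (by positivity)
      nlinarith [ht.1]
    | succ j ih =>
      intro t ht
      have hj0 : 0 < θ ^ j := by positivity
      have hj1 : θ ^ j ≤ 1 := pow_le_one₀ hθ0.le hθ1
      have ha : τ / 4 ≤ τ - τ / 2 * θ ^ j := by nlinarith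
      have ha' : τ - τ / 2 * θ ^ j ≤ τ := by nlinarith
      have hj2 : θ ^ (j + 1) ≤ θ ^ j := by rw [pow_succ]; nlinarith
      have ha0 : 0 ≤ τ - τ / 2 * θ ^ j := by linarith
      have := forced_growth (m := B * (M * 2 ^ j) ^ p) hμ ha0 ha (by positivity) hv hF
        (hFnn _ ⟨ha0, ha'⟩) (hvel _ ⟨ha0, ha'⟩) hPi
        (by
          filter_upwards [hPF] with r hr hr'
          refine le_trans ?_ (hr ⟨ha0.trans hr'.1, hr'.2⟩)
          have h1 := ih r hr'
          gcongr
          exact h1.trans (le_abs_self _)) h t ⟨by nlinarith [ht.1], ht.2⟩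
      refine le_trans ?_ this
      have hd : (τ / 2 * θ ^ j * (1 - θ)) ^ 2 ≤ (t - (τ - τ / 2 * θ ^ j)) ^ 2 := by
        have h1 := ht.1
        rw [pow_succ] at h1
        refine pow_le_pow_left₀ (mul_nonneg (by positivity) (by linarith)) ?_ 2
        nlinarith
      have h2 : (1 / 4 : ℝ) ^ μ * (B * (M * 2 ^ j) ^ p) * ((τ / 2 * θ ^ j * (1 - θ)) ^ 2 / 2)
          = ((1 / 4) ^ μ * (1 - θ) ^ 2 / 16 * (B * M ^ (p - 1) * τ ^ 2)) * (M * 2 ^ (j + 1)) := by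
        have h3 : ((2 : ℝ) ^ j) ^ p * (θ ^ j) ^ 2 = 2 ^ j := by
          rw [← Real.rpow_natCast 2 j, ← Real.rpow_mul (by norm_num), mul_comm (j : ℝ) p,
            Real.rpow_mul (by norm_num), Real.rpow_natCast, Real.rpow_natCast, ← pow_mul,
            mul_comm j 2, pow_mul, ← mul_pow, hθ2]
        rw [Real.mul_rpow hM0.le (by positivity), hMp]
        linear_combination ((1 / 4) ^ μ * B * M ^ (p - 1) * M * τ ^ 2 / 8 * (1 - θ) ^ 2) * h3
      calc M * 2 ^ (j + 1) ≤ _ := le_mul_of_one_le_left (by positivity) hcon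
        _ = _ := h2.symm
        _ ≤ _ := by gcongr
  have hlim : Filter.Tendsto (fun j : ℕ => (2 : ℝ) ^ j) Filter.atTop Filter.atTop :=
    tendsto_pow_atTop_atTop_of_one_lt (by norm_num)
  obtain ⟨j, hj⟩ := (hlim.eventually_gt_atTop (F τ / M)).exists
  have h1 := hstep j τ ⟨by have : 0 < θ ^ j := by positivity
                           nlinarith, le_rfl⟩
  rw [div_lt_iff₀ hM0] at hj
  linarith

/-! ### The modified Bessel series and its growth -/

/-- The denominators `4ᵏ k! a (a + 1) ⋯ (a + k - 1)` of the modified Bessel series. -/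
def besselDenom (a : ℝ) (k : ℕ) : ℝ := ∏ j ∈ Finset.range k, (4 * ((j : ℝ) + 1) * (a + j))

/-- The entire function `s ↦ ∑ sᵏ / (4ᵏ k! (a)ₖ)`, for which `r ↦ besselSeries a (r²)` is a multiple
of `r^(1-a) I_{a-1}(r)`. -/
def besselSeries (a s : ℝ) : ℝ := ∑' k : ℕ, s ^ k / besselDenom a k

lemma besselDenom_succ (a : ℝ) (k : ℕ) :
    besselDenom a (k + 1) = besselDenom a k * (4 * ((k : ℝ) + 1) * (a + k)) :=
  Finset.prod_range_succ _ _

/-- Splits off the first factor of the Pochhammer symbol instead of the last; this is why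
differentiating the series raises `a` by one. -/
lemma besselDenom_shift (a : ℝ) (k : ℕ) :
    besselDenom a (k + 1) = 4 * a * ((k : ℝ) + 1) * besselDenom (a + 1) k := by
  induction k with
  | zero => simp [besselDenom]
  | succ k ih =>
    rw [besselDenom_succ, ih, besselDenom_succ (a + 1) k]
    push_cast
    ring

lemma factorial_le_besselDenom {a : ℝ} (ha : 1 ≤ a) (k : ℕ) :
    (k.factorial : ℝ) ≤ besselDenom a k := by
  induction k with
  | zero => simp [besselDenom]
  | succ k ih =>
    rw [besselDenom_succ, Nat.factorial_succ]
    push_cast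
    have hk : (0 : ℝ) ≤ k := k.cast_nonneg
    have h1 : (k : ℝ) + 1 ≤ 4 * ((k : ℝ) + 1) * (a + k) := by nlinarith
    calc ((k : ℝ) + 1) * k.factorial = k.factorial * ((k : ℝ) + 1) := mul_comm _ _
      _ ≤ _ := mul_le_mul ih h1 (by positivity) (le_trans (by positivity) ih)

lemma besselDenom_pos {a : ℝ} (ha : 1 ≤ a) (k : ℕ) : 0 < besselDenom a k :=
  lt_of_lt_of_le (by positivity) (factorial_le_besselDenom ha k)

lemma summable_besselSeries {a : ℝ} (ha : 1 ≤ a) (s : ℝ) :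
    Summable fun k : ℕ => s ^ k / besselDenom a k := by
  refine Summable.of_norm_bounded (Real.summable_pow_div_factorial |s|) fun k => ?_
  rw [norm_div, norm_pow, Real.norm_eq_abs, Real.norm_eq_abs, abs_of_pos (besselDenom_pos ha k)]
  exact div_le_div_of_nonneg_left (by positivity) (by positivity) (factorial_le_besselDenom ha k)

/-- Termwise differentiation, dominated on the ball of radius `|s| + 1` by the derivative of the
exponential series. The index shift then absorbs the factor `k + 1` into the denominator for `a +
1`. -/
lemma hasDerivAt_besselSeries {a : ℝ} (ha : 1 ≤ a) (s : ℝ) :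
    HasDerivAt (besselSeries a) (besselSeries (a + 1) s / (4 * a)) s := by
  obtain ⟨R, hR⟩ : ∃ R, R = |s| + 1 := ⟨_, rfl⟩
  have hs : s ∈ Metric.ball (0 : ℝ) R := by simp [hR]
  have hsum : Summable fun k : ℕ => (k : ℝ) * R ^ (k - 1) / k.factorial := by
    rw [← summable_nat_add_iff 1]
    refine (Real.summable_pow_div_factorial R).congr fun k => ?_
    rw [Nat.factorial_succ, Nat.add_sub_cancel]
    push_cast
    field_simp
  have key := hasDerivAt_tsum_of_isPreconnected (t := Metric.ball (0 : ℝ) R)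
    (g := fun k y => y ^ k / besselDenom a k)
    (g' := fun k y => (k : ℝ) * y ^ (k - 1) / besselDenom a k) hsum
    Metric.isOpen_ball (convex_ball 0 R).isPreconnected
    (fun k y _ => (hasDerivAt_pow k y).div_const _) (fun k y hy => by
      rw [norm_div, norm_mul, norm_pow, Real.norm_eq_abs (besselDenom a k),
        abs_of_pos (besselDenom_pos ha k), Real.norm_natCast]
      have hy' : ‖y‖ ≤ R := (mem_ball_zero_iff.1 hy).le
      have hR0 : 0 ≤ R := (norm_nonneg y).trans hy'
      exact div_le_div₀ (by positivity) (by gcongr) (by positivity)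
        (factorial_le_besselDenom ha k)) hs (summable_besselSeries ha s) hs
  refine key.congr_deriv ?_
  have hsm : Summable fun k : ℕ => (k : ℝ) * s ^ (k - 1) / besselDenom a k := by
    refine Summable.of_norm_bounded hsum fun k => ?_
    rw [norm_div, norm_mul, norm_pow, Real.norm_eq_abs (besselDenom a k),
      abs_of_pos (besselDenom_pos ha k), Real.norm_natCast]
    have hy' : ‖s‖ ≤ R := (mem_ball_zero_iff.1 hs).le
    have hR0 : 0 ≤ R := (norm_nonneg s).trans hy'
    exact div_le_div₀ (by positivity) (by gcongr) (by positivity) (factorial_le_besselDenom ha k)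
  rw [hsm.tsum_eq_zero_add, besselSeries, ← tsum_div_const]
  simp only [CharP.cast_eq_zero, zero_mul, zero_div, zero_add, Nat.add_sub_cancel]
  refine tsum_congr fun k => ?_
  have h1 := (besselDenom_pos (a := a + 1) (by linarith) k).ne'
  rw [besselDenom_shift]
  push_cast
  field_simp

/-- The modified Bessel equation, in the form of a contiguity relation. -/
lemma besselSeries_eq {a : ℝ} (ha : 1 ≤ a) (s : ℝ) :
    besselSeries (a + 1) s + s * besselSeries (a + 2) s / (4 * a * (a + 1)) = besselSeries a s := by
  have h1 := summable_besselSeries (a := a + 1) (by linarith) s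
  have h2 := summable_besselSeries (a := a + 2) (by linarith) s
  rw [besselSeries, besselSeries, besselSeries, h1.tsum_eq_zero_add,
    (summable_besselSeries ha s).tsum_eq_zero_add, mul_div_assoc, ← tsum_div_const,
    ← tsum_mul_left, add_assoc,
    ← Summable.tsum_add ((summable_nat_add_iff 1).2 h1) ((h2.div_const _).mul_left s)]
  refine congr_arg₂ _ (by simp [besselDenom]) (tsum_congr fun k => ?_)
  have e1 := (besselDenom_pos (a := a + 1) (by linarith) k).ne'
  have e2 := (besselDenom_pos (a := a + 2) (by linarith) k).ne'
  have h3 : (a + 1 + k : ℝ) * besselDenom (a + 1) k = (a + 1) * besselDenom (a + 2) k := by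
    have h4 := besselDenom_shift (a + 1) k
    rw [besselDenom_succ, show a + 1 + 1 = a + 2 by ring] at h4
    have h5 : (0 : ℝ) < k + 1 := by positivity
    have h6 : (4 * ((k : ℝ) + 1)) ≠ 0 := by positivity
    apply mul_left_cancel₀ h6
    linarith
  have h7 : besselDenom (a + 2) k = (a + 1 + k) * besselDenom (a + 1) k / (a + 1) := by
    rw [h3]; field_simp
  have h8 : (a + 1 + k : ℝ) ≠ 0 := by positivity
  rw [besselDenom_shift a k, besselDenom_succ, h7, pow_succ]
  field_simp
  ring

lemma one_le_besselSeries {a s : ℝ} (ha : 1 ≤ a) (hs : 0 ≤ s) : 1 ≤ besselSeries a s := by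
  have := (summable_besselSeries ha s).le_tsum 0
    (fun k _ => div_nonneg (pow_nonneg hs k) (besselDenom_pos ha k).le)
  simpa [besselSeries, besselDenom] using this

lemma contDiff_besselSeries {a : ℝ} (ha : 1 ≤ a) : ContDiff ℝ ∞ (besselSeries a) := by
  rw [contDiff_infty]
  intro m
  induction m generalizing a with
  | zero =>
    exact contDiff_zero.2 (continuous_iff_continuousAt.2
      fun s => (hasDerivAt_besselSeries ha s).continuousAt)
  | succ m ih =>
    push_cast
    refine contDiff_succ_iff_deriv.2
      ⟨fun s => (hasDerivAt_besselSeries ha s).differentiableAt, by simp, ?_⟩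
    have : deriv (besselSeries a) = fun s => besselSeries (a + 1) s / (4 * a) :=
      funext fun s => (hasDerivAt_besselSeries ha s).deriv
    rw [this]
    exact (ih (by linarith)).div_const _

lemma hasDerivAt_besselSeries_sq {a : ℝ} (ha : 1 ≤ a) (r : ℝ) :
    HasDerivAt (fun y => besselSeries a (y ^ 2)) (r * besselSeries (a + 1) (r ^ 2) / (2 * a)) r := by
  have := (hasDerivAt_besselSeries ha (r ^ 2)).comp r (hasDerivAt_pow 2 r)
  refine this.congr_deriv ?_
  push_cast
  field_simp
  ring

lemma besselSeries_sq_mono {a r s : ℝ} (ha : 1 ≤ a) (hr : 0 ≤ r) (hrs : r ≤ s) :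
    besselSeries a (r ^ 2) ≤ besselSeries a (s ^ 2) := by
  have hm : MonotoneOn (fun y => besselSeries a (y ^ 2)) (Ici 0) := by
    refine monotoneOn_of_hasDerivWithinAt_nonneg (convex_Ici 0)
      (fun x _ => (hasDerivAt_besselSeries_sq ha x).continuousAt.continuousWithinAt)
      (fun x _ => (hasDerivAt_besselSeries_sq ha x).hasDerivWithinAt) fun x hx => ?_
    have hx0 : 0 ≤ x := interior_subset hx
    have := one_le_besselSeries (a := a + 1) (by linarith) (sq_nonneg x)
    positivity
  exact hm hr (hr.trans hrs) hrs

/-- The upper bound `e^r (1 + r)^(1/2 - a)` for the radial profile, by comparison of the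
logarithmic derivative with a Riccati supersolution. -/
lemma exists_besselSeries_sq_le {a : ℝ} (ha : 1 ≤ a) :
    ∃ C > 0, ∀ r, 0 ≤ r →
      besselSeries a (r ^ 2) ≤ C * (Real.exp r * (1 + r) ^ (-((2 * a - 1) / 2))) := by
  set φ : ℝ → ℝ := fun r => besselSeries a (r ^ 2) with hφ
  set φ' : ℝ → ℝ := fun r => r * besselSeries (a + 1) (r ^ 2) / (2 * a) with hφ'
  obtain ⟨d, hd⟩ : ∃ d, d = 2 * a - 1 := ⟨_, rfl⟩
  have hd1 : 1 ≤ d := by linarith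
  have hφd : ∀ r, HasDerivAt φ (φ' r) r := hasDerivAt_besselSeries_sq ha
  have hφd' : ∀ r, 0 < r → HasDerivAt φ' (φ r - d / r * φ' r) r := by
    intro r hr
    refine (((hasDerivAt_id' r).mul (hasDerivAt_besselSeries_sq (a := a + 1) (by linarith) r)).div_const
      (2 * a)).congr_deriv ?_
    have := besselSeries_eq ha (r ^ 2)
    simp only [hφ, hφ', ← this, hd, show a + 1 + 1 = a + 2 by ring]
    field_simp
    ring
  have hpos : ∀ r, 1 ≤ φ r := fun r => one_le_besselSeries ha (sq_nonneg r)
  -- The term `φ' 1 / φ 1`, with `d²` absorbing `-d/2`, gives `Q 1 ≥ φ' 1 / φ 1`; the rest makes `Q'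
  -- + Q² + (d/r) Q ≥ 1` for all `r ≥ 1`.
  obtain ⟨b, hb⟩ : ∃ b, b = 1 + d ^ 2 + φ' 1 / φ 1 := ⟨_, rfl⟩
  have hφ'1 : 0 ≤ φ' 1 / φ 1 := by
    have := one_le_besselSeries (a := a + 1) (by linarith) (sq_nonneg (1 : ℝ))
    have := hpos 1
    simp only [hφ']
    positivity
  set Q : ℝ → ℝ := fun r => 1 - d / (2 * r) + b / r ^ 2 with hQ
  have hQd : ∀ r, 0 < r → HasDerivAt Q (d / (2 * r ^ 2) - 2 * b / r ^ 3) r := by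
    intro r hr
    exact ((((hasDerivAt_const r d).div ((hasDerivAt_id' r).const_mul 2) (by positivity)).const_sub
      1).add ((hasDerivAt_const r b).div ((hasDerivAt_id' r).fun_pow 2) (by positivity))).congr_deriv
        (by field_simp; ring)
  -- As in `exp_growth`: `L (-d/2)` is a primitive of `Q` and `L (d/2)` one of `Q + d/r`, the
  -- exponent of the integrating factor for `φ' - Q φ`.
  set L : ℝ → ℝ → ℝ := fun c r => r + c * Real.log r - b / r with hL
  have hLd : ∀ c r, 0 < r → HasDerivAt (L c) (1 + c / r + b / r ^ 2) r := by
    intro c r hr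
    exact (((hasDerivAt_id' r).add ((Real.hasDerivAt_log hr.ne').const_mul c)).sub
      ((hasDerivAt_const r b).div (hasDerivAt_id' r) hr.ne')).congr_deriv (by ring)
  have hD : ∀ r, 1 ≤ r → φ' r ≤ Q r * φ r := by
    intro r hr
    have hanti : AntitoneOn (fun x => Real.exp (L (d / 2) x) * (φ' x - Q x * φ x)) (Ici 1) := by
      have hder : ∀ x : ℝ, 1 ≤ x → HasDerivAt
          (fun x => Real.exp (L (d / 2) x) * (φ' x - Q x * φ x)) _ x := fun x hx =>
        (hLd (d / 2) x (by linarith)).exp.mul ((hφd' x (by linarith)).sub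
          ((hQd x (by linarith)).mul (hφd x)))
      refine antitoneOn_of_hasDerivWithinAt_nonpos (convex_Ici 1)
        (fun x hx => (hder x hx).continuousAt.continuousWithinAt)
        (fun x hx => (hder x (interior_subset hx)).hasDerivWithinAt) fun x hx => ?_
      have hx1 : 1 ≤ x := interior_subset hx
      obtain ⟨y, hy⟩ : ∃ y, y = 1 / x := ⟨_, rfl⟩
      have hric : 1 ≤ (d / (2 * x ^ 2) - 2 * b / x ^ 3) + Q x ^ 2 + d / x * Q x := by
        have : (d / (2 * x ^ 2) - 2 * b / x ^ 3) + Q x ^ 2 + d / x * Q x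
            = 1 + y ^ 2 * (d / 2 - d ^ 2 / 4 + 2 * b - 2 * b * y + b ^ 2 * y ^ 2) := by
          simp only [hQ, hy]
          field_simp
          ring
        rw [this]
        have : 0 ≤ d / 2 - d ^ 2 / 4 + 2 * b - 2 * b * y + b ^ 2 * y ^ 2 := by
          nlinarith [sq_nonneg (b * y - 1)]
        nlinarith [sq_nonneg y]
      have h1 := mul_nonneg (mul_nonneg (Real.exp_pos (L (d / 2) x)).le
        (sub_nonneg.2 hric)) (zero_le_one.trans (hpos x))
      have h2 : 1 + d / 2 / x + b / x ^ 2 = d / x + Q x := by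
        simp only [hQ]
        field_simp
        ring
      rw [h2]
      linarith
    have h1 := hanti self_mem_Ici hr hr
    have h2 : φ' 1 - Q 1 * φ 1 ≤ 0 := by
      have h3 : φ' 1 / φ 1 ≤ Q 1 := by
        simp only [hQ]
        nlinarith
      rw [div_le_iff₀ (by linarith [hpos 1])] at h3
      linarith
    have h4 := mul_nonpos_of_nonneg_of_nonpos (Real.exp_pos (L (d / 2) 1)).le h2
    have h5 := h1.trans h4
    have := nonpos_of_mul_nonpos_right h5 (Real.exp_pos _)
    linarith
  have hanti : AntitoneOn (fun x => φ x * Real.exp (-L (-(d / 2)) x)) (Ici 1) := by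
    have hder : ∀ x : ℝ, 1 ≤ x → HasDerivAt
        (fun x => φ x * Real.exp (-L (-(d / 2)) x)) _ x := fun x hx =>
      (hφd x).mul (hLd (-(d / 2)) x (by linarith)).neg.exp
    refine antitoneOn_of_hasDerivWithinAt_nonpos (convex_Ici 1)
      (fun x hx => (hder x hx).continuousAt.continuousWithinAt)
      (fun x hx => (hder x (interior_subset hx)).hasDerivWithinAt) fun x hx => ?_
    have hx1 : 1 ≤ x := interior_subset hx
    have h1 := mul_nonneg (Real.exp_pos (-L (-(d / 2)) x)).le (sub_nonneg.2 (hD x hx1))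
    have h2 : 1 + -(d / 2) / x + b / x ^ 2 = Q x := by
      simp only [hQ]
      field_simp
      ring
    rw [h2, Pi.neg_apply]
    linarith
  have hb0 : 0 ≤ b := by rw [hb]; positivity
  set C := φ 1 * Real.exp b * 2 ^ (d / 2) with hC
  have hφ1 : 0 < φ 1 := by linarith [hpos 1]
  have hexpb : 1 ≤ Real.exp b := Real.one_le_exp hb0
  refine ⟨C, by positivity, fun r hr => ?_⟩
  rw [← hd, Real.rpow_neg (by linarith), ← div_eq_mul_inv, ← mul_div_assoc,
    le_div_iff₀ (by positivity)]
  -- The comparison starts at `r = 1`, since `Q` is singular at the origin; on `[0, 1]` monotonicity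
  -- of the profile suffices.
  rcases le_total r 1 with h1 | h1
  · have e1 : φ r ≤ φ 1 := besselSeries_sq_mono ha hr h1
    have e2 : (1 + r) ^ (d / 2) ≤ 2 ^ (d / 2) :=
      Real.rpow_le_rpow (by linarith) (by linarith) (by linarith)
    calc φ r * (1 + r) ^ (d / 2) ≤ φ 1 * 2 ^ (d / 2) := by gcongr
      _ ≤ φ 1 * 2 ^ (d / 2) * (Real.exp b * Real.exp r) :=
        le_mul_of_one_le_right (by positivity)
          (one_le_mul_of_one_le_of_one_le hexpb (Real.one_le_exp hr))
      _ = C * Real.exp r := by rw [hC]; ring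
  · have hr0 : 0 < r := by linarith
    have e1 := hanti self_mem_Ici h1 h1
    simp only at e1
    have e2 : φ r ≤ φ 1 * (Real.exp (L (-(d / 2)) r) * Real.exp (-L (-(d / 2)) 1)) := by
      have h4 := mul_le_mul_of_nonneg_left e1 (Real.exp_pos (L (-(d / 2)) r)).le
      have h5 : Real.exp (L (-(d / 2)) r) * (φ r * Real.exp (-L (-(d / 2)) r)) = φ r := by
        rw [mul_left_comm, ← Real.exp_add]; simp
      rw [h5] at h4
      linarith
    have e3 : Real.exp (L (-(d / 2)) r) * Real.exp (-L (-(d / 2)) 1) * r ^ (d / 2)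
        ≤ Real.exp b * Real.exp r := by
      rw [Real.rpow_def_of_pos hr0, ← Real.exp_add, ← Real.exp_add, ← Real.exp_add]
      refine Real.exp_le_exp.2 ?_
      have : 0 ≤ b / r := by positivity
      simp only [hL, Real.log_one]
      linarith
    have e4 : (1 + r) ^ (d / 2) ≤ 2 ^ (d / 2) * r ^ (d / 2) := by
      rw [← Real.mul_rpow (by norm_num) hr]
      exact Real.rpow_le_rpow (by linarith) (by linarith) (by linarith)
    calc φ r * (1 + r) ^ (d / 2)
        ≤ φ 1 * (Real.exp (L (-(d / 2)) r) * Real.exp (-L (-(d / 2)) 1))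
          * (2 ^ (d / 2) * r ^ (d / 2)) := by gcongr
      _ = φ 1 * 2 ^ (d / 2)
          * (Real.exp (L (-(d / 2)) r) * Real.exp (-L (-(d / 2)) 1) * r ^ (d / 2)) := by ring
      _ ≤ φ 1 * 2 ^ (d / 2) * (Real.exp b * Real.exp r) := by gcongr
      _ = C * Real.exp r := by rw [hC]; ring

/-- A power is slowly varying compared with an exponential. -/
lemma exists_one_add_rpow_le (β : ℝ) {δ : ℝ} (hδ : 0 < δ) :
    ∃ C > 0, ∀ y ρ : ℝ, 0 ≤ y → y ≤ ρ →
      (1 + y) ^ β ≤ C * ((1 + ρ) ^ β * Real.exp (δ * (ρ - y))) := by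
  obtain ⟨k, hk⟩ : ∃ k, k = max 1 (|β| / δ) := ⟨_, rfl⟩
  have hk1 : 1 ≤ k := hk ▸ le_max_left _ _
  have hkδ : |β| ≤ δ * k := by
    have : |β| / δ ≤ k := hk ▸ le_max_right _ _
    rw [div_le_iff₀ hδ] at this
    linarith
  refine ⟨k ^ |β|, by positivity, fun y ρ hy hyρ => ?_⟩
  have hρ : 0 ≤ ρ := hy.trans hyρ
  have hkβ : 1 ≤ k ^ |β| := Real.one_le_rpow hk1 (abs_nonneg β)
  have hexp : 1 ≤ Real.exp (δ * (ρ - y)) :=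
    Real.one_le_exp (mul_nonneg hδ.le (sub_nonneg.2 hyρ))
  rcases le_total 0 β with hβ | hβ
  · have h1 : (1 + y) ^ β ≤ (1 + ρ) ^ β := Real.rpow_le_rpow (by linarith) (by linarith) hβ
    calc (1 + y) ^ β ≤ (1 + ρ) ^ β := h1
      _ ≤ (1 + ρ) ^ β * (k ^ |β| * Real.exp (δ * (ρ - y))) :=
        le_mul_of_one_le_right (by positivity) (one_le_mul_of_one_le_of_one_le hkβ hexp)
      _ = _ := by ring
  · have hβ' : β = -|β| := by rw [abs_of_nonpos hβ]; ring
    -- For negative exponents: `1 + ρ ≤ (1 + y)(1 + ρ - y)`, and `1 + z ≤ k e^(z/k)` for `z ≥ 0`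
    -- because `k ≥ 1`. Raised to the power `|β|` this costs the rate `|β| / k ≤ δ`.
    have h1 : (1 + ρ) ≤ (1 + y) * (k * Real.exp ((ρ - y) / k)) := by
      have h2 : 1 + (ρ - y) ≤ k * Real.exp ((ρ - y) / k) := by
        have h3 := Real.add_one_le_exp ((ρ - y) / k)
        have h4 : k * ((ρ - y) / k + 1) = ρ - y + k := by field_simp
        nlinarith
      nlinarith
    have h2 := Real.rpow_le_rpow (by linarith) h1 (abs_nonneg β)
    rw [Real.mul_rpow (by linarith) (by positivity), Real.mul_rpow (by linarith) (by positivity),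
      ← Real.exp_mul] at h2
    have h3 : Real.exp ((ρ - y) / k * |β|) ≤ Real.exp (δ * (ρ - y)) := by
      refine Real.exp_le_exp.2 ?_
      rw [div_mul_eq_mul_div, div_le_iff₀ (by linarith)]
      nlinarith
    rw [hβ', abs_neg, abs_abs, Real.rpow_neg (by linarith), Real.rpow_neg (by linarith)]
    have p1 : 0 < (1 + y) ^ |β| := by positivity
    have p2 : 0 < (1 + ρ) ^ |β| := by positivity
    rw [inv_eq_one_div, inv_mul_eq_div, ← mul_div_assoc, div_le_div_iff₀ p1 p2, one_mul]
    calc (1 + ρ) ^ |β| ≤ _ := h2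
      _ ≤ (1 + y) ^ |β| * (k ^ |β| * Real.exp (δ * (ρ - y))) := by gcongr
      _ = _ := by ring

/-! ### The radial eigenfunction of the Laplacian -/

/-- The radial solution of `Δφ = φ` on `ℝⁿ`. -/
def radialExp (n : ℕ) (x : Space n) : ℝ := besselSeries ((n : ℝ) / 2) (‖x‖ ^ 2)

lemma one_le_half {n : ℕ} (hn : 2 ≤ n) : (1 : ℝ) ≤ (n : ℝ) / 2 := by
  have : (2 : ℝ) ≤ n := by exact_mod_cast hn
  linarith

lemma contDiff_radialExp {n : ℕ} (hn : 2 ≤ n) : ContDiff ℝ ∞ (radialExp n) :=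
  (contDiff_besselSeries (one_le_half hn)).comp (contDiff_norm_sq ℝ)

lemma one_le_radialExp {n : ℕ} (hn : 2 ≤ n) (x : Space n) : 1 ≤ radialExp n x :=
  one_le_besselSeries (one_le_half hn) (sq_nonneg _)

/-- The Laplacian `∑ᵢ ∂ᵢ ∂ᵢ θ`. -/
def coordLaplacian {n : ℕ} (θ : Space n → ℝ) (x : Space n) : ℝ :=
  ∑ i : Fin n, fderiv ℝ (fun y => fderiv ℝ θ y (EuclideanSpace.single i 1)) x
    (EuclideanSpace.single i 1)

lemma hasFDerivAt_besselSeries_norm_sq {n : ℕ} {a : ℝ} (ha : 1 ≤ a) (x : Space n) :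
    HasFDerivAt (fun y : Space n => besselSeries a (‖y‖ ^ 2))
      ((besselSeries (a + 1) (‖x‖ ^ 2) / (2 * a)) • innerSL ℝ x) x := by
  have h1 := (hasDerivAt_besselSeries ha (‖x‖ ^ 2)).comp_hasFDerivAt x
    (hasStrictFDerivAt_norm_sq x).hasFDerivAt
  refine h1.congr_fderiv ?_
  ext y
  simp
  field_simp
  ring

/-- With `a = n/2`, summing the second derivatives gives `n / (2a) = 1` times the series for `a +
1`, plus `‖x‖²` times the one for `a + 2`: exactly the left side of `besselSeries_eq`. -/
lemma coordLaplacian_radialExp {n : ℕ} (hn : 2 ≤ n) (x : Space n) :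
    coordLaplacian (radialExp n) x = radialExp n x := by
  obtain ⟨a, ha⟩ : ∃ a, a = (n : ℝ) / 2 := ⟨_, rfl⟩
  have ha1 : 1 ≤ a := ha ▸ one_le_half hn
  have hcoord : ∀ (i : Fin n) (y : Space n),
      innerSL ℝ y (EuclideanSpace.single i 1) = y i := fun i y => by
    simp [EuclideanSpace.inner_single_right]
  have hφ : radialExp n = fun y : Space n => besselSeries a (‖y‖ ^ 2) := by
    ext y; rw [radialExp, ha]
  have h1 : ∀ i : Fin n, (fun y => fderiv ℝ (radialExp n) y (EuclideanSpace.single i 1))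
      = fun y : Space n => besselSeries (a + 1) (‖y‖ ^ 2) * (y i / (2 * a)) := by
    intro i
    ext y
    rw [hφ, (hasFDerivAt_besselSeries_norm_sq ha1 y).fderiv, smul_apply,
      hcoord, smul_eq_mul]
    ring
  have h2 : ∀ i : Fin n, fderiv ℝ (fun y => fderiv ℝ (radialExp n) y (EuclideanSpace.single i 1)) x
      (EuclideanSpace.single i 1) = besselSeries (a + 1) (‖x‖ ^ 2) / (2 * a)
        + besselSeries (a + 2) (‖x‖ ^ 2) / (4 * a * (a + 1)) * x i ^ 2 := by
    intro i
    have hl : HasFDerivAt (fun y : Space n => y i / (2 * a))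
        ((1 / (2 * a)) • (EuclideanSpace.proj i : Space n →L[ℝ] ℝ)) x := by
      have := ((EuclideanSpace.proj i : Space n →L[ℝ] ℝ).hasFDerivAt (x := x)).const_smul
        (1 / (2 * a))
      refine this.congr_of_eventuallyEq (Filter.Eventually.of_forall fun y => ?_)
      simp
      ring
    rw [h1 i, ((hasFDerivAt_besselSeries_norm_sq (a := a + 1) (by linarith) x).fun_mul hl).fderiv]
    rw [add_apply, smul_apply,
      smul_apply, smul_apply,
      smul_apply, hcoord, show a + 1 + 1 = a + 2 by ring]
    simp
    field_simp
    ring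
  rw [coordLaplacian, Finset.sum_congr rfl fun i _ => h2 i, Finset.sum_add_distrib,
    ← Finset.mul_sum, ← EuclideanSpace.real_norm_sq_eq, hφ]
  simp only [Finset.sum_const, Finset.card_univ, Fintype.card_fin, nsmul_eq_mul]
  rw [← besselSeries_eq ha1, show (n : ℝ) = 2 * a by rw [ha]; ring]
  field_simp

/-- `∫_{|x| ≤ ρ} φ^q ≤ C (1 + ρ)^((n-1)(1 - q/2)) e^(qρ)` for the radial solution `φ`. -/
lemma exists_integral_radialExp_rpow_le {n : ℕ} (hn : 2 ≤ n) {q : ℝ} (hq : 0 < q) :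
    ∃ C > 0, ∀ ρ, 0 ≤ ρ → ∫ x in Metric.closedBall (0 : Space n) ρ, radialExp n x ^ q
      ≤ C * ((1 + ρ) ^ (((n : ℝ) - 1) * (1 - q / 2)) * Real.exp (q * ρ)) := by
  have ha := one_le_half hn
  obtain ⟨C₁, hC₁, hb⟩ := exists_besselSeries_sq_le ha
  -- The rate `q/2` spends half of `e^(qy)` on moving the power from `y` to `ρ`; the other half
  -- keeps the radial integral controlled by its value at `ρ`.
  obtain ⟨C₂, hC₂, hs⟩ := exists_one_add_rpow_le (((n : ℝ) - 1) * (1 - q / 2)) (half_pos hq)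
  set β := ((n : ℝ) - 1) * (1 - q / 2) with hβ
  have hvol : 0 < volume.real (Metric.ball (0 : Space n) 1) :=
    ENNReal.toReal_pos (Metric.measure_ball_pos volume _ one_pos).ne' measure_ball_lt_top.ne
  have hn0 : (0 : ℝ) < n := by have : 0 < n := by omega
                               exact_mod_cast this
  refine ⟨n * volume.real (Metric.ball (0 : Space n) 1) * (C₁ ^ q * C₂ * (2 / q)), by positivity,
    fun ρ hρ => ?_⟩
  have hpt : ∀ y ∈ Ioc 0 ρ, y ^ (n - 1) * besselSeries ((n : ℝ) / 2) (y ^ 2) ^ q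
      ≤ C₁ ^ q * C₂ * ((1 + ρ) ^ β * Real.exp (q / 2 * ρ)) * Real.exp (q / 2 * y) := by
    intro y hy
    have hy0 : 0 ≤ y := hy.1.le
    have e0 := (zero_le_one.trans (one_le_besselSeries ha (sq_nonneg y)))
    have e1 := Real.rpow_le_rpow e0 (hb y hy0) hq.le
    have e2 : y ^ (n - 1) ≤ (1 + y) ^ ((n : ℝ) - 1) := by
      rw [show (n : ℝ) - 1 = ((n - 1 : ℕ) : ℝ) by rw [Nat.cast_sub (by omega), Nat.cast_one],
        Real.rpow_natCast]
      exact pow_le_pow_left₀ hy0 (by linarith) _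
    have e3 := mul_le_mul e2 e1 (Real.rpow_nonneg e0 _) (by positivity)
    refine e3.trans ?_
    have e4 := hs y ρ hy0 hy.2
    calc (1 + y) ^ ((n : ℝ) - 1)
          * (C₁ * (Real.exp y * (1 + y) ^ (-((2 * ((n : ℝ) / 2) - 1) / 2)))) ^ q
        = C₁ ^ q * Real.exp (q * y) * (1 + y) ^ β := by
          rw [Real.mul_rpow hC₁.le (by positivity), Real.mul_rpow (by positivity) (by positivity),
            ← Real.exp_mul, ← Real.rpow_mul (by positivity), mul_comm y q]
          have : (1 + y) ^ β = (1 + y) ^ ((n : ℝ) - 1)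
              * (1 + y) ^ (-((2 * ((n : ℝ) / 2) - 1) / 2) * q) := by
            rw [← Real.rpow_add (by positivity)]
            congr 1
            rw [hβ]; ring
          rw [this]; ring
      _ ≤ C₁ ^ q * Real.exp (q * y) * (C₂ * ((1 + ρ) ^ β * Real.exp (q / 2 * (ρ - y)))) := by
          gcongr
      _ = _ := by
          have : Real.exp (q * y) * Real.exp (q / 2 * (ρ - y))
              = Real.exp (q / 2 * ρ) * Real.exp (q / 2 * y) := by
            rw [← Real.exp_add, ← Real.exp_add]; congr 1; ring
          linear_combination (C₁ ^ q * C₂ * (1 + ρ) ^ β) * this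
  have hcont : Continuous fun y : ℝ => y ^ (n - 1) * besselSeries ((n : ℝ) / 2) (y ^ 2) ^ q := by
    refine (continuous_pow _).mul ?_
    exact ((contDiff_besselSeries ha).continuous.comp (continuous_pow 2)).rpow_const
      fun y => Or.inr hq.le
  have hpolar : ∫ x in Metric.closedBall (0 : Space n) ρ, radialExp n x ^ q
      = n * volume.real (Metric.ball (0 : Space n) 1)
        * ∫ y in (0 : ℝ)..ρ, y ^ (n - 1) * besselSeries ((n : ℝ) / 2) (y ^ 2) ^ q := by
    have : Nonempty (Fin n) := ⟨⟨0, by omega⟩⟩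
    have h1 := integral_fun_norm_addHaar (volume : Measure (Space n))
      ((Iic ρ).indicator fun y => besselSeries ((n : ℝ) / 2) (y ^ 2) ^ q)
    rw [← integral_indicator Metric.isClosed_closedBall.measurableSet]
    have h2 : (Metric.closedBall (0 : Space n) ρ).indicator (fun x => radialExp n x ^ q)
        = fun x => (Iic ρ).indicator (fun y => besselSeries ((n : ℝ) / 2) (y ^ 2) ^ q) ‖x‖ := by
      ext x
      simp [indicator, radialExp]
    have h3 : (fun y : ℝ => y ^ (n - 1) • (Iic ρ).indicator
          (fun y => besselSeries ((n : ℝ) / 2) (y ^ 2) ^ q) y)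
        = (Iic ρ).indicator fun y => y ^ (n - 1) * besselSeries ((n : ℝ) / 2) (y ^ 2) ^ q := by
      ext y
      simp [indicator]
    rw [h2, h1, finrank_euclideanSpace_fin, h3, intervalIntegral.integral_of_le hρ,
      setIntegral_indicator measurableSet_Iic, Ioi_inter_Iic, nsmul_eq_mul, smul_eq_mul, mul_assoc]
  rw [hpolar, mul_assoc (n * volume.real (Metric.ball (0 : Space n) 1))]
  refine mul_le_mul_of_nonneg_left ?_ (by positivity)
  have hint : ∫ y in (0 : ℝ)..ρ, Real.exp (q / 2 * y) ≤ 2 / q * Real.exp (q / 2 * ρ) := by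
    rw [intervalIntegral.integral_comp_mul_left (fun y => Real.exp y) (by positivity),
      integral_exp, smul_eq_mul, inv_div]
    refine mul_le_mul_of_nonneg_left ?_ (by positivity)
    linarith [Real.exp_pos (q / 2 * 0)]
  calc ∫ y in (0 : ℝ)..ρ, y ^ (n - 1) * besselSeries ((n : ℝ) / 2) (y ^ 2) ^ q
      ≤ ∫ y in (0 : ℝ)..ρ,
          C₁ ^ q * C₂ * ((1 + ρ) ^ β * Real.exp (q / 2 * ρ)) * Real.exp (q / 2 * y) := by
        refine intervalIntegral.integral_mono_on_of_le_Ioo hρ (hcont.intervalIntegrable _ _)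
          (Continuous.intervalIntegrable (by fun_prop) _ _) fun y hy => hpt y ⟨hy.1, hy.2.le⟩
    _ = C₁ ^ q * C₂ * ((1 + ρ) ^ β * Real.exp (q / 2 * ρ))
          * ∫ y in (0 : ℝ)..ρ, Real.exp (q / 2 * y) := intervalIntegral.integral_const_mul _ _
    _ ≤ C₁ ^ q * C₂ * ((1 + ρ) ^ β * Real.exp (q / 2 * ρ))
          * (2 / q * Real.exp (q / 2 * ρ)) := by gcongr
    _ = _ := by
        have : Real.exp (q * ρ) = Real.exp (q / 2 * ρ) * Real.exp (q / 2 * ρ) := by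
          rw [← Real.exp_add]; congr 1; ring
        rw [this]; ring

/-! ### From the weak formulation to ODEs for moments -/

lemma contDiff_dirDeriv {n : ℕ} {θ : Space n → ℝ} (hθ : ContDiff ℝ ∞ θ) (e : Space n) :
    ContDiff ℝ ∞ fun y => fderiv ℝ θ y e :=
  (hθ.fderiv_right (m := ∞) le_rfl).clm_apply contDiff_const

lemma coordLaplacian_congr {n : ℕ} {θ φ : Space n → ℝ} {x : Space n}
    (h : θ =ᶠ[𝓝 x] φ) : coordLaplacian θ x = coordLaplacian φ x := by
  refine Finset.sum_congr rfl fun i _ => ?_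
  have : (fun y => fderiv ℝ θ y (EuclideanSpace.single i 1)) =ᶠ[𝓝 x]
      fun y => fderiv ℝ φ y (EuclideanSpace.single i 1) := by
    filter_upwards [h.fderiv (𝕜 := ℝ)] with y hy
    rw [hy]
  rw [this.fderiv_eq]

/-- Green's identity for a weak gradient and a test function. -/
lemma IsWeakGradient.integral_inner_gradient {n : ℕ} {v : Space n → ℝ} {w : Space n → Space n}
    (h : IsWeakGradient v w) (hv : MemLp v 2 volume) (hw : MemLp w 2 volume)
    {θ : Space n → ℝ} (hθ : ContDiff ℝ ∞ θ) (hc : HasCompactSupport θ) :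
    ∫ x, inner ℝ (w x) (gradient θ x) = - ∫ x, v x * coordLaplacian θ x := by
  have hd : ∀ i : Fin n, ContDiff ℝ ∞ fun y => fderiv ℝ θ y (EuclideanSpace.single i 1) :=
    fun i => contDiff_dirDeriv hθ _
  have hdc : ∀ i : Fin n,
      HasCompactSupport fun y => fderiv ℝ θ y (EuclideanSpace.single i 1) :=
    fun i => hc.fderiv_apply ℝ _
  have hw' : ∀ i : Fin n, MemLp (fun x => w x i) 2 volume := fun i =>
    (EuclideanSpace.proj i : Space n →L[ℝ] ℝ).comp_memLp' hw
  have hint : ∀ i : Fin n,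
      Integrable (fun x => fderiv ℝ θ x (EuclideanSpace.single i 1) * w x i) volume := fun i =>
    MemLp.integrable_mul ((hd i).continuous.memLp_of_hasCompactSupport (hdc i) (p := 2)) (hw' i)
  have hint' : ∀ i : Fin n, Integrable (fun x => v x * fderiv ℝ
      (fun y => fderiv ℝ θ y (EuclideanSpace.single i 1)) x (EuclideanSpace.single i 1)) volume :=
    fun i => MemLp.integrable_mul hv
      ((contDiff_dirDeriv (hd i) _).continuous.memLp_of_hasCompactSupport
        ((hdc i).fderiv_apply ℝ _) (p := 2))
  have hcomp : ∀ i : Fin n, ∫ x, fderiv ℝ θ x (EuclideanSpace.single i 1) * w x i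
      = - ∫ x, v x * fderiv ℝ (fun y => fderiv ℝ θ y (EuclideanSpace.single i 1)) x
        (EuclideanSpace.single i 1) := by
    intro i
    -- The weak gradient is tested with `∂ᵢθ`; the `i`-th component of the resulting vector identity
    -- is the one needed.
    have h1 := h _ (hd i) (hdc i)
    have hgc : Continuous (gradient fun y => fderiv ℝ θ y (EuclideanSpace.single i 1)) :=
      (InnerProductSpace.toDual ℝ (Space n)).symm.continuous.comp
        ((hd i).continuous_fderiv (by simp))
    have hgs : HasCompactSupport (gradient fun y => fderiv ℝ θ y (EuclideanSpace.single i 1)) :=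
      ((hdc i).fderiv ℝ).comp_left (map_zero (InnerProductSpace.toDual ℝ (Space n)).symm)
    have i1 : Integrable (fun x => v x • gradient
        (fun y => fderiv ℝ θ y (EuclideanSpace.single i 1)) x) volume :=
      memLp_one_iff_integrable.1 ((hgc.memLp_of_hasCompactSupport hgs (p := 2)).smul hv)
    have i2 : Integrable (fun x => fderiv ℝ θ x (EuclideanSpace.single i 1) • w x) volume :=
      memLp_one_iff_integrable.1
        (hw.smul ((hd i).continuous.memLp_of_hasCompactSupport (hdc i) (p := 2)))
    have h2 := congrArg (EuclideanSpace.proj i : Space n →L[ℝ] ℝ) h1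
    rw [map_neg, ← ContinuousLinearMap.integral_comp_comm _ i1,
      ← ContinuousLinearMap.integral_comp_comm _ i2] at h2
    have h3 : ∀ x, (gradient (fun y => fderiv ℝ θ y (EuclideanSpace.single i 1)) x) i
        = fderiv ℝ (fun y => fderiv ℝ θ y (EuclideanSpace.single i 1)) x
          (EuclideanSpace.single i 1) := fun x => by
      rw [← inner_gradient_left, EuclideanSpace.inner_single_right]
      simp
    simp only [map_smul, PiLp.proj_apply, smul_eq_mul, h3] at h2
    linarith
  have hl : ∀ x, inner ℝ (w x) (gradient θ x)
      = ∑ i : Fin n, fderiv ℝ θ x (EuclideanSpace.single i 1) * w x i := by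
    intro x
    rw [real_inner_comm, inner_gradient_left]
    have : w x = ∑ i : Fin n, w x i • EuclideanSpace.single i (1 : ℝ) := by
      ext j
      simp [Finset.sum_apply, Pi.single_apply]
    conv_lhs => rw [this]
    simp [mul_comm]
  simp only [hl, coordLaplacian, Finset.mul_sum]
  rw [integral_finsetSum _ fun i _ => hint i, integral_finsetSum _ fun i _ => hint' i,
    ← Finset.sum_neg_distrib]
  exact Finset.sum_congr rfl fun i _ => hcomp i

/-- The energy identity tested with a time-independent test function. -/
lemma energyIdentity_space {n : ℕ} {μ p : ℝ} {T : EReal} {u : Space n × ℝ → ℝ}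
    {U V : ℝ → Lp ℝ 2 (volume : Measure (Space n))}
    {W : ℝ → Lp (Space n) 2 (volume : Measure (Space n))}
    (hW : ∀ t ∈ timeInterval T, IsWeakGradient (U t) (W t))
    (hE : ∀ φ : Space n × ℝ → ℝ, IsTestFunction T φ →
      ∀ t ∈ timeInterval T, EnergyIdentity μ p u V W φ t)
    {τ : ℝ} (hτ : 0 ≤ τ) (hτT : (τ : EReal) < T)
    {θ : Space n → ℝ} (hθ : ContDiff ℝ ∞ θ) (hc : HasCompactSupport θ) :
    ∀ t ∈ Icc 0 τ, (∫ x, V t x * θ x) - (∫ x, V 0 x * θ x)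
      - (∫ s in (0 : ℝ)..t, ∫ x, U s x * coordLaplacian θ x)
      + (∫ s in (0 : ℝ)..t, μ / (1 + s) * ∫ x, V s x * θ x)
      = ∫ s in (0 : ℝ)..t, ∫ x, |u (x, s)| ^ p * θ x := by
  obtain ⟨τ', hττ', hτ'T⟩ := EReal.lt_iff_exists_real_btwn.1 hτT
  have hττ' : τ < τ' := by exact_mod_cast hττ'
  have hmem : ∀ t ∈ Icc 0 τ, t ∈ timeInterval T := fun t ht =>
    ⟨ht.1, lt_of_le_of_lt (by exact_mod_cast ht.2) hτT⟩
  -- A time cutoff equal to `1` near `[0, τ]`, so its derivative vanishes there, and supported in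
  -- times at most `τ' < T`.
  let η : ContDiffBump (τ / 2) :=
    ⟨τ / 2 + (τ' - τ) / 2, τ / 2 + (τ' - τ), by linarith, by linarith⟩
  have hηball : ∀ t ∈ Icc 0 τ, t ∈ Metric.ball (τ / 2) η.rIn := by
    intro t ht
    rw [Metric.mem_ball, Real.dist_eq, abs_lt]
    constructor <;> simp only [η] <;> linarith [ht.1, ht.2]
  have hη1 : ∀ t ∈ Icc 0 τ, η t = 1 := fun t ht =>
    η.one_of_mem_closedBall (Metric.ball_subset_closedBall (hηball t ht))
  set ψ : Space n × ℝ → ℝ := fun z => θ z.1 * η z.2 with hψ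
  have hts : tsupport ψ ⊆ tsupport θ ×ˢ tsupport η := by
    refine closure_minimal (fun z hz => ?_)
      ((isClosed_tsupport θ).prod (isClosed_tsupport η))
    have hz' : θ z.1 * η z.2 ≠ 0 := hz
    exact ⟨subset_tsupport _ (left_ne_zero_of_mul hz'), subset_tsupport _ (right_ne_zero_of_mul hz')⟩
  have htest : IsTestFunction T ψ := by
    refine ⟨(hθ.comp contDiff_fst).mul (η.contDiff.comp contDiff_snd), ?_, fun z hz => ?_⟩
    · exact (hc.isCompact.prod η.hasCompactSupport.isCompact).of_isClosed_subset
        (isClosed_tsupport ψ) hts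
    · have h1 := (hts hz).2
      rw [η.tsupport_eq, Metric.mem_closedBall, Real.dist_eq] at h1
      have h2 := (abs_le.1 h1).2
      have h3 : z.2 ≤ τ' := by
        have : η.rOut = τ / 2 + (τ' - τ) := rfl
        linarith
      exact lt_of_le_of_lt (by exact_mod_cast h3) hτ'T
  intro t ht
  have key := hE ψ htest t (hmem t ht)
  rw [EnergyIdentity] at key
  have hsub : ∀ s ∈ uIcc 0 t, s ∈ Icc 0 τ := fun s hs => by
    rw [uIcc_of_le ht.1] at hs
    exact ⟨hs.1, hs.2.trans ht.2⟩
  have e1 : ∀ s ∈ Icc 0 τ, ∀ x, ψ (x, s) = θ x := fun s hs x => by simp [hψ, hη1 s hs]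
  have e2 : ∀ s ∈ Icc 0 τ, ∀ x, deriv (fun r => ψ (x, r)) s = 0 := fun s hs x => by
    have : (fun r => ψ (x, r)) =ᶠ[𝓝 s] fun _ => θ x := by
      filter_upwards [η.eventuallyEq_one_of_mem_ball (hηball s hs)] with r hr
      simp [hψ, hr]
    rw [this.deriv_eq, deriv_const]
  have e3 : ∀ s ∈ Icc 0 τ, (fun y => ψ (y, s)) = θ := fun s hs => funext (e1 s hs)
  have i1 : (∫ s in (0 : ℝ)..t, ∫ x, (-(V s x * deriv (fun r => ψ (x, r)) s)
      + inner ℝ (W s x) (gradient (fun y => ψ (y, s)) x)))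
      = - ∫ s in (0 : ℝ)..t, ∫ x, U s x * coordLaplacian θ x := by
    rw [← intervalIntegral.integral_neg]
    refine intervalIntegral.integral_congr fun s hs => ?_
    have hs' := hsub s hs
    simp only [e2 s hs', e3 s hs', mul_zero, neg_zero, zero_add]
    exact (hW s (hmem s hs')).integral_inner_gradient (Lp.memLp _) (Lp.memLp _) hθ hc
  have i2 : (∫ s in (0 : ℝ)..t, ∫ x, μ * V s x / (1 + s) * ψ (x, s))
      = ∫ s in (0 : ℝ)..t, μ / (1 + s) * ∫ x, V s x * θ x := by
    refine intervalIntegral.integral_congr fun s hs => ?_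
    simp only [e1 s (hsub s hs)]
    rw [← integral_const_mul]
    exact integral_congr_ae (Filter.Eventually.of_forall fun x => by ring)
  have i3 : (∫ s in (0 : ℝ)..t, ∫ x, |u (x, s)| ^ p * ψ (x, s))
      = ∫ s in (0 : ℝ)..t, ∫ x, |u (x, s)| ^ p * θ x :=
    intervalIntegral.integral_congr fun s hs => by simp only [e1 s (hsub s hs)]
  rw [i1, i2, i3] at key
  simp only [e1 t ht, e1 0 (left_mem_Icc.2 hτ)] at key
  linarith

/-- Moments become inner products with a fixed `L²` element, so continuity and differentiability in
time pass from the `L²`-valued curves to the moments. -/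
lemma inner_toLp_eq_integral {n : ℕ} {θ : Space n → ℝ} (hθ : MemLp θ 2 volume)
    (f : Lp ℝ 2 (volume : Measure (Space n))) :
    inner ℝ (hθ.toLp θ) f = ∫ x, f x * θ x := by
  rw [L2.inner_def]
  refine integral_congr_ae ?_
  filter_upwards [hθ.coeFn_toLp] with x hx
  rw [hx]
  rfl

/-- Local `L^p` integrability in space-time gives integrability of `|u|^p θ` on time slabs. -/
lemma integrable_rpow_mul {n : ℕ} {p : ℝ} (hp : 1 < p) {u : Space n × ℝ → ℝ} {τ ρ : ℝ}
    (hu : MemLp u (ENNReal.ofReal p)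
      (volume.restrict (Metric.closedBall (0 : Space n) ρ ×ˢ Icc 0 τ)))
    {θ : Space n → ℝ} (hθ : Continuous θ) (hs : ∀ x, x ∉ Metric.closedBall (0 : Space n) ρ → θ x = 0)
    {M : ℝ} (hM : ∀ x, ‖θ x‖ ≤ M) :
    (∀ᵐ s, s ∈ Icc 0 τ → Integrable (fun x => |u (x, s)| ^ p * θ x) volume) ∧
    IntegrableOn (fun s => ∫ x, |u (x, s)| ^ p * θ x) (Icc 0 τ) volume := by
  have h1 := hu.integrable_norm_rpow (by simp; linarith) ENNReal.ofReal_ne_top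
  rw [ENNReal.toReal_ofReal (by linarith)] at h1
  have h2 : Integrable (fun z : Space n × ℝ => ‖u z‖ ^ p * θ z.1)
      ((volume.restrict (Metric.closedBall (0 : Space n) ρ)).prod (volume.restrict (Icc 0 τ))) := by
    rw [Measure.prod_restrict, ← Measure.volume_eq_prod]
    exact h1.mul_bdd (by fun_prop) (Filter.Eventually.of_forall fun z => hM z.1)
  have hz : ∀ s, Function.support (fun x => |u (x, s)| ^ p * θ x)
      ⊆ Metric.closedBall (0 : Space n) ρ := fun s x hx => by
    by_contra hcon
    exact hx (by simp [hs x hcon])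
  constructor
  · have h3 := h2.prod_left_ae
    rw [ae_restrict_iff' measurableSet_Icc] at h3
    filter_upwards [h3] with s hs' hsI
    exact (integrableOn_iff_integrable_of_support_subset (hz s)).1 (hs' hsI)
  · have h3 := h2.integral_prod_right
    refine h3.congr (Filter.Eventually.of_forall fun s => ?_)
    exact setIntegral_eq_integral_of_forall_compl_eq_zero fun x hx => by
      simp [hs x hx]

/-- For a nonnegative solution of `Δφ = κφ`, the moment `∫ u φ` of an energy solution supported in
the cone satisfies `h'' + μ/(1+t) h' = κ h + P` with `P = ∫ |u|^p φ` almost everywhere. -/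
lemma exists_moment_ode {n : ℕ} {μ p R : ℝ} (hp : 1 < p) (hR : 0 ≤ R)
    {T : EReal} {u : Space n × ℝ → ℝ} {u₀ u₁ : Space n → ℝ}
    (hu : IsEnergySolution μ p T u₀ u₁ u) (hcone : SupportedInCone T R u)
    (hu₁ : ∀ᵐ x, 0 ≤ u₁ x) {τ : ℝ} (hτ : 0 ≤ τ) (hτT : (τ : EReal) < T)
    {φ : Space n → ℝ} (hφ : ContDiff ℝ ∞ φ) (hφ0 : ∀ x, 0 ≤ φ x) {κ : ℝ}
    (hlap : ∀ x, coordLaplacian φ x = κ * φ x) :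
    ∃ h v P : ℝ → ℝ, ContinuousOn v (Icc 0 τ) ∧
      (∀ t ∈ Icc 0 τ, HasDerivWithinAt h (v t) (Icc 0 τ) t) ∧
      (∀ t ∈ Icc 0 τ, h t = ∫ x in Metric.closedBall (0 : Space n) (t + R), u (x, t) * φ x) ∧
      0 ≤ v 0 ∧ IntervalIntegrable P volume 0 τ ∧ (∀ t, 0 ≤ P t) ∧
      (∀ᵐ t, t ∈ Icc 0 τ →
        IntegrableOn (fun x => |u (x, t)| ^ p * φ x) (Metric.closedBall (0 : Space n) (t + R)) ∧
        ∫ x in Metric.closedBall (0 : Space n) (t + R), |u (x, t)| ^ p * φ x ≤ P t) ∧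
      (∀ s ∈ Icc 0 τ, ∀ t ∈ Icc 0 τ, s ≤ t →
        v t - v s = ∫ r in s..t, (κ * h r + P r - μ / (1 + r) * v r)) := by
  obtain ⟨U, V, W, hU, hW, -, -, hder, hV, hLp, -, hV0, hE⟩ := hu
  -- The cutoff is `1` on a ball exceeding the largest cone slice by the margin `1`, so `φ χ` and
  -- its Laplacian agree with those of `φ` wherever `u` may be nonzero.
  let χ : ContDiffBump (0 : Space n) := ⟨τ + R + 1, τ + R + 2, by linarith, by linarith⟩
  have hmem : ∀ t ∈ Icc 0 τ, t ∈ timeInterval T := fun t ht =>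
    ⟨ht.1, lt_of_le_of_lt (by exact_mod_cast ht.2) hτT⟩
  set θ : Space n → ℝ := fun x => φ x * χ x with hθ
  have hθs : ContDiff ℝ ∞ θ := hφ.mul χ.contDiff
  have hθc : HasCompactSupport θ := χ.hasCompactSupport.mul_left
  have hθ2 : MemLp θ 2 volume := hθs.continuous.memLp_of_hasCompactSupport hθc
  have hθ0 : ∀ x, 0 ≤ θ x := fun x => mul_nonneg (hφ0 x) χ.nonneg
  have hθφ : ∀ x, x ∈ Metric.ball (0 : Space n) (τ + R + 1) → θ =ᶠ[𝓝 x] φ := fun x hx => by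
    filter_upwards [χ.eventuallyEq_one_of_mem_ball hx] with y hy
    simp [hθ, hy]
  have hball : ∀ t ∈ Icc 0 τ, Metric.closedBall (0 : Space n) (t + R)
      ⊆ Metric.ball (0 : Space n) (τ + R + 1) := fun t ht =>
    Metric.closedBall_subset_ball (by linarith [ht.2])
  have hUz : ∀ t ∈ Icc 0 τ, ∀ᵐ x : Space n,
      x ∉ Metric.closedBall (0 : Space n) (t + R) → U t x = 0 := fun t ht => by
    filter_upwards [hU t (hmem t ht), hcone t (hmem t ht)] with x h1 h2 h3
    rw [← h1]
    exact h2 (by simpa using h3)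
  have hh : ∀ t ∈ Icc 0 τ, ∫ x, U t x * θ x
      = ∫ x in Metric.closedBall (0 : Space n) (t + R), u (x, t) * φ x := fun t ht => by
    rw [← setIntegral_eq_integral_of_ae_compl_eq_zero
      (s := Metric.closedBall (0 : Space n) (t + R))]
    · refine setIntegral_congr_ae Metric.isClosed_closedBall.measurableSet ?_
      filter_upwards [hU t (hmem t ht)] with x h1 h2
      rw [h1, (hθφ x (hball t ht h2)).eq_of_nhds]
    · filter_upwards [hUz t ht] with x h1 h2
      rw [h1 h2, zero_mul]
  have hk : ∀ t ∈ Icc 0 τ, ∫ x, U t x * coordLaplacian θ x = κ * ∫ x, U t x * θ x := by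
    intro t ht
    rw [← integral_const_mul]
    refine integral_congr_ae ?_
    filter_upwards [hUz t ht] with x h1
    by_cases hx : x ∈ Metric.closedBall (0 : Space n) (t + R)
    · have h2 := hθφ x (hball t ht hx)
      rw [coordLaplacian_congr h2, hlap, h2.eq_of_nhds]
      ring
    · rw [h1 hx]; ring
  have hIT : Icc 0 τ ⊆ timeInterval T := hmem
  obtain ⟨M, hM⟩ := hθs.continuous.bounded_above_of_compact_support hθc
  have hθsupp : ∀ x, x ∉ Metric.closedBall (0 : Space n) (τ + R + 2) → θ x = 0 := fun x hx => by
    have : χ x = 0 := χ.zero_of_le_dist (by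
      have := not_le.1 (fun h => hx (Metric.mem_closedBall.2 h))
      exact this.le)
    simp [hθ, this]
  have hP := integrable_rpow_mul hp (hLp _
    ((isCompact_closedBall (0 : Space n) (τ + R + 2)).prod (isCompact_Icc (a := 0) (b := τ)))
    (prod_mono (subset_univ _) hIT)) hθs.continuous hθsupp hM
  have hvd : ContinuousOn (fun t => ∫ x, V t x * θ x) (Icc 0 τ) := by
    simp_rw [← inner_toLp_eq_integral hθ2]
    exact continuousOn_const.inner (𝕜 := ℝ) (hV.mono hIT)
  have hhd : ∀ t ∈ Icc 0 τ, HasDerivWithinAt (fun t => ∫ x, U t x * θ x)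
      (∫ x, V t x * θ x) (Icc 0 τ) t := by
    intro t ht
    simp_rw [← inner_toLp_eq_integral hθ2]
    have := (hasDerivWithinAt_const t (Icc 0 τ) (hθ2.toLp θ)).inner ℝ
      ((hder t (hmem t ht)).mono hIT)
    simpa using this
  have hPint : IntervalIntegrable (fun s => ∫ x, |u (x, s)| ^ p * θ x) volume 0 τ :=
    (intervalIntegrable_iff_integrableOn_Icc_of_le hτ).2 hP.2
  refine ⟨fun t => ∫ x, U t x * θ x, fun t => ∫ x, V t x * θ x,
    fun s => ∫ x, |u (x, s)| ^ p * θ x, hvd, hhd, hh, ?_, hPint, ?_, ?_, ?_⟩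
  · refine integral_nonneg_of_ae ?_
    filter_upwards [hV0, hu₁] with x h1 h2
    exact mul_nonneg (h1 ▸ h2) (hθ0 x)
  · exact fun t => integral_nonneg fun x => mul_nonneg (by positivity) (hθ0 x)
  · filter_upwards [hP.1] with t ht htI
    have h1 := ht htI
    have h2 : EqOn (fun x => |u (x, t)| ^ p * θ x) (fun x => |u (x, t)| ^ p * φ x)
        (Metric.closedBall (0 : Space n) (t + R)) := fun x hx => by
      simp only [(hθφ x (hball t htI hx)).eq_of_nhds]
    refine ⟨h1.integrableOn.congr_fun h2 Metric.isClosed_closedBall.measurableSet, ?_⟩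
    rw [← setIntegral_congr_fun Metric.isClosed_closedBall.measurableSet h2]
    exact setIntegral_le_integral h1 (Filter.Eventually.of_forall fun x =>
      mul_nonneg (by positivity) (hθ0 x))
  · intro s hs t ht hst
    have key := energyIdentity_space hW hE hτ hτT hθs hθc
    have ci : ∀ {a b : ℝ}, a ∈ Icc 0 τ → b ∈ Icc 0 τ → uIcc a b ⊆ Icc 0 τ := fun ha hb =>
      uIcc_subset_Icc ha hb
    have h0 : (0 : ℝ) ∈ Icc 0 τ := left_mem_Icc.2 hτ
    have c1 : ∀ {a b : ℝ}, a ∈ Icc 0 τ → b ∈ Icc 0 τ →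
        IntervalIntegrable (fun s => κ * ∫ x, U s x * θ x) volume a b := fun ha hb =>
      ((continuousOn_const.mul fun x hx => (hhd x hx).continuousWithinAt).mono
        (ci ha hb)).intervalIntegrable
    have c2 : ∀ {a b : ℝ}, a ∈ Icc 0 τ → b ∈ Icc 0 τ →
        IntervalIntegrable (fun s => μ / (1 + s) * ∫ x, V s x * θ x) volume a b := fun ha hb =>
      (((continuousOn_div_one_add μ le_rfl).mul hvd).mono (ci ha hb)).intervalIntegrable
    have c3 : ∀ {a b : ℝ}, a ∈ Icc 0 τ → b ∈ Icc 0 τ →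
        IntervalIntegrable (fun s => ∫ x, |u (x, s)| ^ p * θ x) volume a b := fun ha hb =>
      hPint.mono_set (by rw [uIcc_of_le hτ]; exact ci ha hb)
    have hint : ∀ r ∈ Icc 0 τ, (∫ x, V r x * θ x) - (∫ x, V 0 x * θ x)
        = ∫ s in (0 : ℝ)..r, (κ * (∫ x, U s x * θ x) + (∫ x, |u (x, s)| ^ p * θ x)
          - μ / (1 + s) * ∫ x, V s x * θ x) := by
      intro r hr
      have h1 := key r hr
      have h2 : (∫ s in (0 : ℝ)..r, ∫ x, U s x * coordLaplacian θ x)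
          = ∫ s in (0 : ℝ)..r, κ * ∫ x, U s x * θ x :=
        intervalIntegral.integral_congr fun s hs => hk s (ci h0 hr hs)
      rw [h2] at h1
      rw [intervalIntegral.integral_sub ((c1 h0 hr).add (c3 h0 hr)) (c2 h0 hr),
        intervalIntegral.integral_add (c1 h0 hr) (c3 h0 hr)]
      linarith
    have h1 := intervalIntegral.integral_interval_sub_left
      (((c1 h0 ht).add (c3 h0 ht)).sub (c2 h0 ht)) (((c1 h0 hs).add (c3 h0 hs)).sub (c2 h0 hs))
    rw [← h1, ← hint t ht, ← hint s hs]
    ring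

/-! ### Hölder bounds and the Strauss exponent -/

/-- Hölder's inequality for moments over a ball. -/
lemma abs_moment_rpow_le {n : ℕ} {p q : ℝ} (hpq : p.HolderConjugate q) {w φ : Space n → ℝ}
    {ρ : ℝ} (hw : AEStronglyMeasurable w volume)
    (hwp : IntegrableOn (fun x => |w x| ^ p) (Metric.closedBall (0 : Space n) ρ) volume)
    (hφ : Continuous φ) (hφ0 : ∀ x, 0 ≤ φ x) :
    |∫ x in Metric.closedBall (0 : Space n) ρ, w x * φ x| ^ p
      ≤ (∫ x in Metric.closedBall (0 : Space n) ρ, |w x| ^ p)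
        * (∫ x in Metric.closedBall (0 : Space n) ρ, φ x ^ q) ^ (p - 1) := by
  have hp := hpq.pos
  have hw' : MemLp w (ENNReal.ofReal p)
      (volume.restrict (Metric.closedBall (0 : Space n) ρ)) := by
    refine (integrable_norm_rpow_iff hw.restrict (by simpa using hp) ENNReal.ofReal_ne_top).1 ?_
    rw [ENNReal.toReal_ofReal hp.le]
    exact hwp
  have hφ' : MemLp φ (ENNReal.ofReal q)
      (volume.restrict (Metric.closedBall (0 : Space n) ρ)) := by
    obtain ⟨M, hM⟩ := (isCompact_closedBall (0 : Space n) ρ).exists_bound_of_continuousOn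
      hφ.continuousOn
    have : IsFiniteMeasure (volume.restrict (Metric.closedBall (0 : Space n) ρ)) :=
      ⟨by rw [Measure.restrict_apply_univ]; exact measure_closedBall_lt_top⟩
    exact MemLp.of_bound hφ.aestronglyMeasurable M
      ((ae_restrict_iff' Metric.isClosed_closedBall.measurableSet).2
        (Filter.Eventually.of_forall hM))
  have h1 := integral_mul_norm_le_Lp_mul_Lq hpq hw' hφ'
  have h2 : |∫ x in Metric.closedBall (0 : Space n) ρ, w x * φ x|
      ≤ ∫ x in Metric.closedBall (0 : Space n) ρ, ‖w x‖ * ‖φ x‖ := by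
    simp_rw [← norm_mul, ← Real.norm_eq_abs]
    exact norm_integral_le_integral_norm fun x => w x * φ x
  have h3 := Real.rpow_le_rpow (abs_nonneg _) (h2.trans h1) hp.le
  refine h3.trans_eq ?_
  have p1 : 0 ≤ ∫ x in Metric.closedBall (0 : Space n) ρ, ‖w x‖ ^ p :=
    integral_nonneg fun x => by positivity
  have p2 : 0 ≤ ∫ x in Metric.closedBall (0 : Space n) ρ, ‖φ x‖ ^ q :=
    integral_nonneg fun x => by positivity
  rw [Real.mul_rpow (by positivity) (by positivity), ← Real.rpow_mul p1, ← Real.rpow_mul p2,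
    one_div_mul_cancel hp.ne', Real.rpow_one]
  have h4 : 1 / q * p = p - 1 := by
    have h5 := hpq.inv_add_inv_eq_one
    have : q⁻¹ = 1 - p⁻¹ := by linarith
    rw [one_div, this]
    field_simp
  rw [h4]
  congr 2
  exact integral_congr_ae (Filter.Eventually.of_forall fun x => by
    simp only [Real.norm_of_nonneg (hφ0 x)])

/-- Completing the square, `4(N-1)γ = D - (2(N-1)p - (N+1))²` with `D = N² + 10N - 7`. The bracket
is below `√D` since `p` is below the root, and above `-√D` since `p > 1` makes it exceed `N - 3`,
while `(N-3)² ≤ D`. -/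
lemma straussGamma_pos {p N : ℝ} (hN : 1 < N) (hp : 1 < p) (h : p < strauss N) :
    0 < straussGamma p N := by
  have hD : 0 ≤ N ^ 2 + 10 * N - 7 := by nlinarith
  rw [strauss, lt_div_iff₀ (by linarith)] at h
  have h1 : 2 * (N - 1) * p - (N + 1) < Real.sqrt (N ^ 2 + 10 * N - 7) := by linarith
  have h2 : -Real.sqrt (N ^ 2 + 10 * N - 7) < 2 * (N - 1) * p - (N + 1) := by
    have h3 : -Real.sqrt (N ^ 2 + 10 * N - 7) ≤ N - 3 := by
      have := Real.abs_le_sqrt (x := N - 3) (y := N ^ 2 + 10 * N - 7) (by nlinarith)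
      exact neg_le_of_neg_le ((neg_le_abs _).trans this)
    nlinarith
  have h4 := sq_lt_sq' h2 h1
  rw [Real.sq_sqrt hD] at h4
  rw [straussGamma]
  have h5 : 0 < (N - 1) * (2 + (N + 1) * p - (N - 1) * p ^ 2) := by nlinarith
  exact pos_of_mul_pos_right h5 (by linarith)

/-- Powers of comparable quantities are comparable. -/
lemma rpow_le_of_comparable {x y c : ℝ} (hx : 0 < x) (hc : 1 ≤ c) (hxy : x ≤ c * y)
    (hyx : y ≤ c * x) (σ : ℝ) : x ^ σ ≤ c ^ |σ| * y ^ σ := by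
  have hc0 : 0 < c := by linarith
  have hy : 0 < y := pos_of_mul_pos_right (hx.trans_le hxy) hc0.le
  rcases le_total 0 σ with hσ | hσ
  · rw [abs_of_nonneg hσ, ← Real.mul_rpow hc0.le hy.le]
    exact Real.rpow_le_rpow hx.le hxy hσ
  · rw [abs_of_nonpos hσ, Real.rpow_neg hc0.le, ← div_eq_inv_mul,
      le_div_iff₀ (by positivity), mul_comm, ← Real.mul_rpow hc0.le hx.le]
    exact Real.rpow_le_rpow_of_nonpos hy hyx hσ

lemma coordLaplacian_const {n : ℕ} (c : ℝ) (x : Space n) :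
    coordLaplacian (fun _ => c) x = 0 := by
  simp [coordLaplacian]

lemma IsEnergySolution.aestronglyMeasurable_slice {n : ℕ} {μ p : ℝ} {T : EReal}
    {u : Space n × ℝ → ℝ} {u₀ u₁ : Space n → ℝ} (hu : IsEnergySolution μ p T u₀ u₁ u) {t : ℝ}
    (ht : t ∈ timeInterval T) : AEStronglyMeasurable (fun x => u (x, t)) volume := by
  obtain ⟨U, V, W, hU, -⟩ := hu
  exact (Lp.aestronglyMeasurable (U t)).congr (Filter.EventuallyEq.symm (hU t ht))

lemma IsEnergySolution.ae_eq_initial {n : ℕ} {μ p : ℝ} {T : EReal}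
    {u : Space n × ℝ → ℝ} {u₀ u₁ : Space n → ℝ} (hu : IsEnergySolution μ p T u₀ u₁ u)
    (hT : 0 < T) : ∀ᵐ x, u (x, 0) = u₀ x := by
  obtain ⟨U, V, W, hU, -, -, -, -, -, -, hU0, -⟩ := hu
  filter_upwards [hU 0 ⟨le_rfl, by simpa using hT⟩, hU0] with x h1 h2
  rw [h1, h2]

/-- Lower bound `∫ |u|^p ≥ c ε^p (1 + t)^(n - 1 - (n + μ - 1) p / 2)` for later times. -/
lemma exists_lower_bound_rpow_mass {n : ℕ} (hn : 2 ≤ n) {μ p R : ℝ} (hμ : 0 ≤ μ) (hp : 1 < p)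
    (hR : 0 ≤ R) {f g : Space n → ℝ} (hf : MemLp f 2 volume)
    (hf0 : ∀ᵐ x, 0 ≤ f x) (hg0 : ∀ᵐ x, 0 ≤ g x)
    (hI : 0 < ∫ x in Metric.closedBall (0 : Space n) R, f x) :
    ∃ c > 0, ∀ ε : ℝ, 0 < ε → ∀ (T : EReal) (u : Space n × ℝ → ℝ),
      IsEnergySolution μ p T (fun x => ε * f x) (fun x => ε * g x) u → SupportedInCone T R u →
      ∀ τ : ℝ, 0 ≤ τ → (τ : EReal) < T → ∀ᵐ t, t ∈ Icc (μ + 2) τ →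
        IntegrableOn (fun x => |u (x, t)| ^ p) (Metric.closedBall (0 : Space n) (t + R)) →
        c * ε ^ p * (1 + t) ^ ((n : ℝ) - 1 - ((n : ℝ) + μ - 1) * p / 2)
          ≤ ∫ x in Metric.closedBall (0 : Space n) (t + R), |u (x, t)| ^ p := by
  have hpq := Real.HolderConjugate.conjExponent hp
  set q := Real.conjExponent p with hq
  obtain ⟨C₂, hC₂, hφint⟩ := exists_integral_radialExp_rpow_le hn hpq.symm.pos
  set I₀ := ∫ x in Metric.closedBall (0 : Space n) R, f x with hI₀
  set β := ((n : ℝ) - 1) * (p / 2 - 1) with hβ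
  set c₁ := I₀ * Real.exp (-(2 * μ + 5)) with hc₁
  have hc₁0 : 0 < c₁ := by positivity
  have hqp : q * (p - 1) = p := by
    have h1 := hpq.sub_one_mul_conj
    linarith
  set D := C₂ ^ (p - 1) * (1 + R) ^ |β| * Real.exp (p * R) with hD
  have hD0 : 0 < D := by positivity
  refine ⟨c₁ ^ p / D, by positivity, fun ε hε T u hu hcone τ hτ hτT => ?_⟩
  have hT : 0 < T := lt_of_le_of_lt (by exact_mod_cast hτ) hτT
  obtain ⟨H, v, P, hv, hH, hHu, hv0, hPi, hP0, -, hode⟩ := exists_moment_ode hp hR hu hcone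
    (by filter_upwards [hg0] with x hx using mul_nonneg hε.le hx) hτ hτT
    (contDiff_radialExp hn) (fun x => zero_le_one.trans (one_le_radialExp hn x)) (κ := 1)
    (fun x => by rw [coordLaplacian_radialExp hn, one_mul])
  have hφc : Continuous (radialExp n) := (contDiff_radialExp hn).continuous
  have hB : MeasurableSet (Metric.closedBall (0 : Space n) R) :=
    Metric.isClosed_closedBall.measurableSet
  have hfin : IsFiniteMeasure (volume.restrict (Metric.closedBall (0 : Space n) R)) :=
    ⟨by rw [Measure.restrict_apply_univ]; exact measure_closedBall_lt_top⟩
  have hfi : Integrable f (volume.restrict (Metric.closedBall (0 : Space n) R)) :=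
    hf.restrict _ |>.integrable (by norm_num)
  have hH0 : ε * I₀ ≤ H 0 := by
    rw [hHu 0 (left_mem_Icc.2 hτ), zero_add, hI₀, ← integral_const_mul]
    have h1 : ∀ᵐ x ∂(volume.restrict (Metric.closedBall (0 : Space n) R)),
        u (x, 0) * radialExp n x = ε * (f x * radialExp n x) := by
      filter_upwards [ae_restrict_of_ae (hu.ae_eq_initial hT)] with x hx
      rw [hx]; ring
    rw [integral_congr_ae h1]
    obtain ⟨M, hM⟩ := (isCompact_closedBall (0 : Space n) R).exists_bound_of_continuousOn
      hφc.continuousOn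
    refine integral_mono_ae (hfi.const_mul ε) ((hfi.mul_bdd hφc.aestronglyMeasurable
      ((ae_restrict_iff' hB).2 (Filter.Eventually.of_forall hM))).const_mul ε) ?_
    filter_upwards [ae_restrict_of_ae hf0] with x hx
    exact mul_le_mul_of_nonneg_left (le_mul_of_one_le_right hx (one_le_radialExp hn x)) hε.le
  have hgrow := exp_growth hμ hv hH ((mul_pos hε hI).trans_le hH0) hv0
    (fun s hs t ht hst => by
      rw [hode s hs t ht hst]
      have hI : Icc s t ⊆ Icc 0 τ := Icc_subset_Icc hs.1 ht.2
      have c0 : IntervalIntegrable H volume s t :=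
        (HasDerivWithinAt.continuousOn fun x hx =>
          (hH x (hI hx)).mono hI).intervalIntegrable_of_Icc hst
      have c1 : IntervalIntegrable (fun r => μ / (1 + r) * v r) volume s t :=
        ((continuousOn_div_one_add μ hs.1).mul (hv.mono hI)).intervalIntegrable_of_Icc hst
      have c2 : IntervalIntegrable P volume s t := hPi.mono_set (by
        rw [uIcc_of_le hst, uIcc_of_le hτ]; exact hI)
      refine intervalIntegral.integral_mono_on hst (c0.sub c1) (((c0.const_mul 1).add c2).sub c1)
        fun x _ => ?_
      have := hP0 x
      linarith)
  refine Filter.Eventually.of_forall fun t ht hup => ?_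
  have ht0 : 0 ≤ t := by linarith [ht.1]
  have h1t : 0 < 1 + t := by linarith
  have htI : t ∈ Icc 0 τ := ⟨ht0, ht.2⟩
  have hlow : ε * c₁ * (Real.exp t * (1 + t) ^ (-(μ / 2))) ≤ H t := by
    refine le_trans ?_ (hgrow t ht)
    have : ε * c₁ ≤ H 0 * Real.exp (-(2 * μ + 5)) := by
      rw [hc₁, ← mul_assoc]
      gcongr
    gcongr
  have hhol := abs_moment_rpow_le hpq
    (hu.aestronglyMeasurable_slice ⟨ht0, lt_of_le_of_lt (by exact_mod_cast ht.2) hτT⟩) hup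
    hφc (fun x => zero_le_one.trans (one_le_radialExp hn x))
  rw [← hHu t htI] at hhol
  set G := ∫ x in Metric.closedBall (0 : Space n) (t + R), |u (x, t)| ^ p with hG
  have hG0 : 0 ≤ G := integral_nonneg fun x => by positivity
  have hJ0 : 0 ≤ ∫ x in Metric.closedBall (0 : Space n) (t + R), radialExp n x ^ q :=
    integral_nonneg fun x =>
      Real.rpow_nonneg (zero_le_one.trans (one_le_radialExp hn x)) _
  have hJ : (∫ x in Metric.closedBall (0 : Space n) (t + R), radialExp n x ^ q) ^ (p - 1)
      ≤ D * ((1 + t) ^ β * Real.exp (p * t)) := by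
    have h1 := Real.rpow_le_rpow hJ0 (hφint (t + R) (by linarith)) (by linarith : 0 ≤ p - 1)
    refine h1.trans ?_
    rw [Real.mul_rpow hC₂.le (by positivity), Real.mul_rpow (by positivity) (by positivity),
      ← Real.exp_mul, ← Real.rpow_mul (by positivity)]
    -- By `q (p - 1) = p` the weight grows like `e^(pt)`, exactly the growth of `|H|^p`, so only
    -- powers of `1 + t` survive.
    have e1 : q * (t + R) * (p - 1) = p * t + p * R := by linear_combination (t + R) * hqp
    have e2 : ((n : ℝ) - 1) * (1 - q / 2) * (p - 1) = β := by
      rw [hβ]; linear_combination (-((n : ℝ) - 1) / 2) * hqp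
    rw [e1, e2, Real.exp_add]
    have h2 : (1 + (t + R)) ^ β ≤ (1 + R) ^ |β| * (1 + t) ^ β :=
      rpow_le_of_comparable (by linarith) (by linarith) (by nlinarith) (by nlinarith) β
    calc C₂ ^ (p - 1) * ((1 + (t + R)) ^ β * (Real.exp (p * t) * Real.exp (p * R)))
        ≤ C₂ ^ (p - 1) * ((1 + R) ^ |β| * (1 + t) ^ β * (Real.exp (p * t) * Real.exp (p * R))) := by
          gcongr
      _ = _ := by rw [hD]; ring
  have hlowp : (ε * c₁ * (Real.exp t * (1 + t) ^ (-(μ / 2)))) ^ p ≤ |H t| ^ p :=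
    Real.rpow_le_rpow (by positivity) (hlow.trans (le_abs_self _)) (by linarith)
  have hall := hlowp.trans (hhol.trans (mul_le_mul_of_nonneg_left hJ hG0))
  clear_value c₁
  rw [Real.mul_rpow (by positivity) (by positivity), Real.mul_rpow hε.le hc₁0.le,
    Real.mul_rpow (by positivity) (by positivity), ← Real.exp_mul, ← Real.rpow_mul h1t.le,
    mul_comm t p] at hall
  have hE : 0 < D * ((1 + t) ^ β * Real.exp (p * t)) := by positivity
  rw [← div_le_iff₀ hE] at hall
  refine le_trans (le_of_eq ?_) hall
  rw [show (n : ℝ) - 1 - ((n : ℝ) + μ - 1) * p / 2 = -(μ / 2) * p - β by rw [hβ]; ring,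
    Real.rpow_sub h1t]
  have := Real.exp_pos (p * t)
  field_simp

/-- Hölder's inequality for the mean `∫ u` over balls of radius at most `(1 + R) τ`. -/
lemma exists_mean_rpow_le (n : ℕ) {p R : ℝ} (hp : 1 < p) (hR : 0 ≤ R) :
    ∃ b > 0, ∀ (w : Space n → ℝ) (t τ : ℝ), 1 ≤ τ → 0 ≤ t → t ≤ τ →
      AEStronglyMeasurable w volume →
      IntegrableOn (fun x => |w x| ^ p) (Metric.closedBall (0 : Space n) (t + R)) →
      b * τ ^ (-((n : ℝ) * (p - 1))) *
        |∫ x in Metric.closedBall (0 : Space n) (t + R), w x * 1| ^ p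
        ≤ ∫ x in Metric.closedBall (0 : Space n) (t + R), |w x| ^ p := by
  have hpq := Real.HolderConjugate.conjExponent hp
  set ν := volume.real (Metric.closedBall (0 : Space n) 1) with hν
  have hν0 : 0 < ν := ENNReal.toReal_pos
    (Metric.measure_closedBall_pos volume _ one_pos).ne' measure_closedBall_lt_top.ne
  set D := (ν * (1 + R) ^ n) ^ (p - 1) with hD
  have hD0 : 0 < D := by positivity
  refine ⟨D⁻¹, by positivity, fun w t τ hτ ht htτ hw hwp => ?_⟩
  have hτ0 : 0 < τ := by linarith
  have h1 := abs_moment_rpow_le hpq hw hwp (continuous_const (y := (1 : ℝ)))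
    (fun _ => zero_le_one)
  have hG0 : 0 ≤ ∫ x in Metric.closedBall (0 : Space n) (t + R), |w x| ^ p :=
    integral_nonneg fun x => by positivity
  have h2 : (∫ _x in Metric.closedBall (0 : Space n) (t + R),
      (1 : ℝ) ^ Real.conjExponent p) ^ (p - 1) ≤ D * τ ^ ((n : ℝ) * (p - 1)) := by
    rw [Real.one_rpow, setIntegral_const, smul_eq_mul, mul_one,
      Measure.addHaar_real_closedBall _ _ (by linarith), finrank_euclideanSpace_fin,
      Real.rpow_mul hτ0.le, Real.rpow_natCast, hD,
      ← Real.mul_rpow (by positivity) (by positivity)]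
    refine Real.rpow_le_rpow (by positivity) ?_ (by linarith)
    have hν' : volume.real (Metric.ball (0 : Space n) 1) ≤ ν :=
      measureReal_mono Metric.ball_subset_closedBall measure_closedBall_lt_top.ne
    have h3 : (t + R) ^ n ≤ ((1 + R) * τ) ^ n :=
      pow_le_pow_left₀ (by linarith) (by nlinarith) n
    rw [mul_pow] at h3
    calc (t + R) ^ n * volume.real (Metric.ball (0 : Space n) 1)
        ≤ ((1 + R) ^ n * τ ^ n) * ν := by gcongr
      _ = _ := by ring
  have h3 := h1.trans (mul_le_mul_of_nonneg_left h2 hG0)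
  rw [Real.rpow_neg hτ0.le, ← mul_inv, inv_mul_eq_div, div_le_iff₀ (by positivity)]
  exact h3

lemma integral_closedBall_pos {n : ℕ} {R : ℝ} {f : Space n → ℝ} (hf : MemLp f 2 volume)
    (hf0 : ∀ᵐ x, 0 ≤ f x) (hne : ¬ ∀ᵐ x, f x = 0)
    (hsupp : ∀ᵐ x : Space n, R < ‖x‖ → f x = 0) :
    0 < ∫ x in Metric.closedBall (0 : Space n) R, f x := by
  have hfin : IsFiniteMeasure (volume.restrict (Metric.closedBall (0 : Space n) R)) :=
    ⟨by rw [Measure.restrict_apply_univ]; exact measure_closedBall_lt_top⟩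
  have hfi : Integrable f (volume.restrict (Metric.closedBall (0 : Space n) R)) :=
    hf.restrict _ |>.integrable (by norm_num)
  have h0 : 0 ≤ᵐ[volume.restrict (Metric.closedBall (0 : Space n) R)] f :=
    ae_restrict_of_ae hf0
  refine (integral_nonneg_of_ae h0).lt_of_ne' fun h => hne ?_
  have h1 := (integral_eq_zero_iff_of_nonneg_ae h0 hfi).1 h
  filter_upwards [(ae_restrict_iff' Metric.isClosed_closedBall.measurableSet).1 h1, hsupp]
    with x h2 h3
  by_cases hx : x ∈ Metric.closedBall (0 : Space n) R
  · exact h2 hx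
  · exact h3 (by simpa using hx)

end DampedWave

end

/-! ### The lifespan estimate -/

theorem theorem1p2 (n : ℕ) (hn : 2 ≤ n) (μ p : ℝ) (hμ : 0 < μ) (hp : 1 < p)
    (hpS : p < DampedWave.strauss ((n : ℝ) + μ))
    (f g : DampedWave.Space n → ℝ)
    (hf : DampedWave.MemH1 f) (hg : MemLp g 2 volume)
    (hf_nonneg : ∀ᵐ x, 0 ≤ f x) (hg_nonneg : ∀ᵐ x, 0 ≤ g x)
    (hf_ne : ¬ (∀ᵐ x, f x = 0)) (hg_ne : ¬ (∀ᵐ x, g x = 0))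
    (R : ℝ) (hR : 1 ≤ R) :
    ∃ ε₀ : ℝ, 0 < ε₀ ∧ ∃ C : ℝ, 0 < C ∧
      ∀ ε : ℝ, 0 < ε → ε ≤ ε₀ →
        ∀ (T : EReal) (u : DampedWave.Space n × ℝ → ℝ), 0 < T →
          DampedWave.IsEnergySolution μ p T (fun x => ε * f x) (fun x => ε * g x) u →
          DampedWave.SupportedInCone T R u →
          T ≤ ((C * ε ^ (-(2 * p * (p - 1) / DampedWave.straussGamma p ((n : ℝ) + μ))) : ℝ) :
            EReal) := by
  open DampedWave in
  have hR0 : 0 ≤ R := by linarith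
  -- If `f` is not supported in the ball of radius `R`, the cone condition at `t = 0` fails for
  -- every solution, and any constants will do.
  by_cases hsupp : ∀ᵐ x : Space n, R < ‖x‖ → f x = 0
  swap
  · refine ⟨1, one_pos, 1, one_pos, fun ε hε _ T u hT hu hcone => absurd ?_ hsupp⟩
    filter_upwards [hu.ae_eq_initial hT, hcone 0 ⟨le_rfl, by simpa using hT⟩] with x h1 h2 h3
    have := h2 (by simpa using h3)
    rw [h1] at this
    exact (mul_eq_zero.1 this).resolve_left hε.ne'
  have hI := integral_closedBall_pos hf.1 hf_nonneg hf_ne hsupp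
  obtain ⟨c, hc, hlow⟩ :=
    exists_lower_bound_rpow_mass hn hμ.le hp hR0 hf.1 hf_nonneg hg_nonneg hI
  obtain ⟨b, hb, hmean⟩ := exists_mean_rpow_le n hp hR0
  have hn2 : (2 : ℝ) ≤ n := by exact_mod_cast hn
  have hγ := straussGamma_pos (p := p) (N := (n : ℝ) + μ) (by linarith) hp hpS
  set γ := straussGamma p ((n : ℝ) + μ) with hγd
  set σ := (n : ℝ) - 1 - ((n : ℝ) + μ - 1) * p / 2 with hσ
  set θ : ℝ := (2 : ℝ) ^ (-((p - 1) / 2)) with hθ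
  have hθ1 : θ < 1 := Real.rpow_lt_one_of_one_lt_of_neg (by norm_num) (by linarith)
  -- On `[τ/4, τ]` the quantities `1 + t` and `τ` agree up to a factor `4`, so `(1 + t)^σ` may be
  -- replaced by `τ^σ` at the cost `4^|σ|`, whatever the sign of `σ`.
  set c' := c / 4 ^ |σ| with hc'
  set K := (1 / 4 : ℝ) ^ μ * (1 - θ) ^ 2 / 16 * (b * ((1 / 4) ^ μ * c' / 32) ^ (p - 1)) with hK
  have hc'0 : 0 < c' := by positivity
  have hK0 : 0 < K := by
    have : 0 < (1 - θ) ^ 2 := by have := sub_pos.2 hθ1; positivity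
    positivity
  -- The first entry, with `ε ≤ 1`, ensures `τ/4 ≥ μ + 2`, where the lower bound on `∫ |u|^p` is
  -- available. The second makes `K ε^(p(p-1)) τ^(γ/2) ≥ 1`, which contradicts `kato_bound`.
  set C := max (4 * (μ + 2)) (K⁻¹ ^ (2 / γ)) with hC
  have hC0 : 0 < C := lt_max_of_lt_left (by linarith)
  refine ⟨1, one_pos, C, hC0, fun ε hε hε1 T u hT hu hcone => ?_⟩
  by_contra! hcon
  obtain ⟨τ, hτ1, hτT⟩ := EReal.lt_iff_exists_real_btwn.1 hcon
  have hτ1 : C * ε ^ (-(2 * p * (p - 1) / γ)) < τ := by exact_mod_cast hτ1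
  have hε2 : 1 ≤ ε ^ (-(2 * p * (p - 1) / γ)) := by
    refine Real.one_le_rpow_of_pos_of_le_one_of_nonpos hε hε1 (neg_nonpos.2 ?_)
    have : 0 < p - 1 := by linarith
    positivity
  have hτ4 : 4 * (μ + 2) ≤ τ :=
    (le_max_left _ _).trans ((le_mul_of_one_le_right hC0.le hε2).trans hτ1.le)
  have hτ0 : 0 < τ := by linarith
  obtain ⟨F, v, P, hv, hF, hFu, hv0, hPi, hP0, hPu, hode⟩ := exists_moment_ode hp hR0 hu hcone
    (by filter_upwards [hg_nonneg] with x hx using mul_nonneg hε.le hx) hτ0.le hτT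
    (φ := fun _ => 1) contDiff_const (fun _ => zero_le_one) (κ := 0)
    (fun x => by rw [coordLaplacian_const, zero_mul])
  simp only [mul_one] at hPu
  have hmem : ∀ t ∈ Icc 0 τ, t ∈ timeInterval T := fun t ht =>
    ⟨ht.1, lt_of_le_of_lt (by exact_mod_cast ht.2) hτT⟩
  have hF0 : 0 ≤ F 0 := by
    rw [hFu 0 (left_mem_Icc.2 hτ0.le)]
    refine integral_nonneg_of_ae (ae_restrict_of_ae ?_)
    filter_upwards [hu.ae_eq_initial hT, hf_nonneg] with x h1 h2
    rw [h1, mul_one]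
    exact mul_nonneg hε.le h2
  have key := kato_bound (m := c' * ε ^ p * τ ^ σ) (B := b * τ ^ (-((n : ℝ) * (p - 1)))) hτ0 hμ.le
    hp (by positivity) (by positivity) hv hF hF0 hv0 hPi
    (by
      filter_upwards [hPu, hlow ε hε T u hu hcone τ hτ0.le hτT] with t h1 h2 ht
      have htI : t ∈ Icc 0 τ := ⟨by linarith [ht.1], ht.2⟩
      obtain ⟨h3, h4⟩ := h1 htI
      refine le_trans ?_ ((h2 ⟨by linarith [ht.1], ht.2⟩ h3).trans h4)
      have h5 : τ ^ σ ≤ 4 ^ |σ| * (1 + t) ^ σ :=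
        rpow_le_of_comparable hτ0 (by norm_num) (by linarith [ht.1]) (by linarith [ht.2]) σ
      calc c' * ε ^ p * τ ^ σ ≤ c' * ε ^ p * (4 ^ |σ| * (1 + t) ^ σ) := by gcongr
        _ = c * ε ^ p * (1 + t) ^ σ := by
          rw [hc']
          field_simp)
    (by
      filter_upwards [hPu] with t h1 htI
      obtain ⟨h3, h4⟩ := h1 htI
      rw [hFu t htI]
      exact (hmean _ t τ (by linarith) htI.1 htI.2
        (hu.aestronglyMeasurable_slice (hmem t htI)) h3).trans h4)
    (fun s hs t ht hst => by
      rw [hode s hs t ht hst]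
      exact intervalIntegral.integral_congr fun r _ => by simp)
  have hscale : (1 / 4 : ℝ) ^ μ * (1 - θ) ^ 2 / 16 * (b * τ ^ (-((n : ℝ) * (p - 1))) *
      ((1 / 4) ^ μ * (c' * ε ^ p * τ ^ σ) * (τ ^ 2 / 32)) ^ (p - 1) * τ ^ 2)
      = K * (ε ^ (p * (p - 1)) * τ ^ (γ / 2)) := by
    have e1 : (1 / 4 : ℝ) ^ μ * (c' * ε ^ p * τ ^ σ) * (τ ^ 2 / 32)
        = ((1 / 4) ^ μ * c' / 32) * (ε ^ p * τ ^ (σ + 2)) := by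
      rw [Real.rpow_add hτ0, Real.rpow_two]; ring
    -- Where `γ` appears: `-n(p-1) + (σ+2)(p-1) + 2 = γ(p, n+μ) / 2`.
    have e2 : τ ^ (γ / 2) = τ ^ (-((n : ℝ) * (p - 1))) * τ ^ ((σ + 2) * (p - 1)) * τ ^ 2 := by
      rw [← Real.rpow_two, ← Real.rpow_add hτ0, ← Real.rpow_add hτ0]
      congr 1
      rw [hγd, hσ, straussGamma]
      ring
    rw [e1, Real.mul_rpow (by positivity) (by positivity),
      Real.mul_rpow (by positivity) (by positivity), ← Real.rpow_mul hε.le,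
      ← Real.rpow_mul hτ0.le, e2, hK]
    ring
  rw [hscale] at key
  have h1 : K⁻¹ * ε ^ (-(p * (p - 1))) ≤ τ ^ (γ / 2) := by
    have h2 := Real.rpow_le_rpow (by positivity) hτ1.le (half_pos hγ).le
    refine le_trans ?_ h2
    rw [Real.mul_rpow hC0.le (by positivity), ← Real.rpow_mul hε.le]
    have h3 : K⁻¹ ≤ C ^ (γ / 2) := by
      have h4 := Real.rpow_le_rpow (by positivity) (le_max_right (4 * (μ + 2)) (K⁻¹ ^ (2 / γ)))
        (half_pos hγ).le
      rwa [← Real.rpow_mul (by positivity), show 2 / γ * (γ / 2) = 1 by field_simp,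
        Real.rpow_one] at h4
    have h5 : -(2 * p * (p - 1) / γ) * (γ / 2) = -(p * (p - 1)) := by field_simp
    rw [h5]
    gcongr
  have h6 : 1 ≤ K * (ε ^ (p * (p - 1)) * τ ^ (γ / 2)) := by
    calc (1 : ℝ) = K * (ε ^ (p * (p - 1)) * (K⁻¹ * ε ^ (-(p * (p - 1))))) := by
          rw [Real.rpow_neg hε.le]
          have : 0 < ε ^ (p * (p - 1)) := by positivity
          field_simp
      _ ≤ _ := by gcongr
  linarith
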